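/- Let $R$ be an associative unital ring with $1\neq 0$ and let $G$ be a group. A character of $G$ is a homomorphism $\chi\colon G\to\mathbb R$; for $N\leqslant G$ let $S(G,N)$ be the set of non-zero characters vanishing on $N$. The Novikov ring $\widehat{R[G]}^{\chi}$ consists of the formal series $\sum_{g\in G} r_g g$ ($r_g\in R$) such that $\{g : r_g\neq 0,\ \chi(g)\leqslant t\}$ is finite for every $t\in\mathbb R$; it is a left $R[G]$-module by left multiplication. For a chain complex $C_\bullet$ of left modules over a ring and a left module $M$, $H^i(C_\bullet;M)$ is the $i$th cohomology of $\mathrm{Hom}(C_\bullet,M)$, and $\mathrm{cd}(C_\bullet)$ is the supremum in $\mathbb Z\cup\{\pm\infty\}$ of all $i$ such that $H^i(C_\bullet;M)\neq 0$ for some $M$. Write $H^i(G;M)=\mathrm{Ext}^i_{R[G]}(R,M)$ and let $\mathrm{cd}_R(G)$ be the projective dimension of the trivial left $R[G]$-module $R$. If $\mathrm{cd}_R(G)=n<\infty$ and $m\geqslant 0$, then $G$ is of type $\mathrm{FP}^*_m(R)$ if the trivial $R[G]$-module $R$ has a projective resolution $P_\bullet$ with $P_i$ finitely generated for all $i>n-m$,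 and $$\Sigma^*_m(G;R)=\{\chi\colon G\to\mathbb R \text{ a non-zero character} : H^i(G;\widehat{R[G]}^{\chi})=0\text{ for all } i>n-m\}.$$ **Theorem.** 1. (Groups) Let $d, n\geqslant 0$ be integers, let $G$ be of type $\mathrm{FP}^*_d(R)$ with $\mathrm{cd}_R(G)=n$, and let $N\trianglelefteqslant G$ be a normal subgroup with $G/N\cong\mathbb Z^d$. If $S(G,N)\subseteq\Sigma^*_d(G;R)$, then $\mathrm{cd}_R(N)=n-d$ (in particular $d\leqslant n$). 2. (Chain complexes) Let $C_\bullet=(C_i)_{i\in\mathbb Z}$ be a chain complex of finitely generated projective left $R[G]$-modules such that $C_i=0$ for all $i>n$, for some $n\in\mathbb Z$, and let $\chi\colon G\to\mathbb R$ be a character whose image is free Abelian of rank $d$. If $H^i(C_\bullet;\widehat{R[G]}^{\varphi})=0$ for all $\varphi\in S(G,\ker\chi)$ and all $i>n-d$, then the restriction of $C_\bullet$ to $R[\ker\chi]$ satisfies $\mathrm{cd}(\mathrm{res}^G_{\ker\chi}C_\bullet)\leqslant n-d$. -/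

import Mathlib

universe u v

open CategoryTheory

noncomputable section

namespace CoAbelian

/-! ### The trivial module and cohomology of groups -/

/-- The augmentation `R[G] → R`, `∑ r_g g ↦ ∑ r_g`, for an arbitrary (not necessarily commutative)
ring `R`. -/
def augmentation (R : Type u) (G : Type v) [Ring R] [Group G] : MonoidAlgebra R G →+* R :=
  MonoidAlgebra.liftNCRingHom (RingHom.id R) 1 (fun _ _ => Commute.one_right _)

/-- The additive group `R`, lifted to the universe of `R[G]`; it carries the trivial `G`-action. -/
def TrivialCarrier (R : Type u) (_G : Type v) : Type (max u v) := ULift.{v} R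

instance (R : Type u) (G : Type v) [Ring R] : AddCommGroup (TrivialCarrier R G) :=
  inferInstanceAs (AddCommGroup (ULift.{v} R))

instance (R : Type u) (G : Type v) [Ring R] : Module R (TrivialCarrier R G) :=
  inferInstanceAs (Module R (ULift.{v} R))

instance (R : Type u) (G : Type v) [Ring R] [Group G] :
    Module (MonoidAlgebra R G) (TrivialCarrier R G) :=
  Module.compHom (TrivialCarrier R G) (augmentation R G)

/-- The trivial left `R[G]`-module `R`. -/
abbrev trivialModule (R : Type u) (G : Type v) [Ring R] [Group G] :
    ModuleCat.{max u v} (MonoidAlgebra R G) :=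
  ModuleCat.of (MonoidAlgebra R G) (TrivialCarrier R G)

/-- The cohomology `H^i(G; M) = Ext^i_{R[G]}(R, M)` of `G` over `R` with coefficients in the left
`R[G]`-module `M`. -/
abbrev groupCohom (R : Type u) (G : Type v) [Ring R] [Group G]
    (M : ModuleCat.{max u v} (MonoidAlgebra R G)) (i : ℕ) : Type (max u v) :=
  Abelian.Ext.{max u v} (trivialModule R G) M i

/-- The cohomological dimension `cd_R(G)`: the projective dimension of the trivial `R[G]`-module
`R`, i.e. the supremum of all `i` with `H^i(G; M) ≠ 0` for some `M`. -/
def cd (R : Type u) (G : Type v) [Ring R] [Group G] : WithBot ℕ∞ :=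
  projectiveDimension (trivialModule R G)

/-- `G` is of type `FP*_m(R)`: `cd_R(G) = n` is finite and the trivial `R[G]`-module `R` has a
projective resolution `P` with `P_i` finitely generated for all `i > n - m`. -/
def IsFPStar (R : Type u) (G : Type v) [Ring R] [Group G] (m : ℕ) : Prop :=
  ∃ n : ℕ, cd R G = n ∧ ∃ P : ProjectiveResolution (trivialModule R G),
    ∀ i : ℕ, (n : ℤ) - m < i → Module.Finite (MonoidAlgebra R G) (P.complex.X i)

/-! ### Characters and Novikov rings -/

/-- Real characters of `G`, i.e. elements of `H^1(G; ℝ)`. The trivial character is `1`. -/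
abbrev Character (G : Type v) [Group G] : Type v := G →* Multiplicative ℝ

/-- The set `S(G, N)` of non-zero characters vanishing on `N`. -/
def charactersVanishingOn {G : Type v} [Group G] (N : Subgroup G) : Set (Character G) :=
  {χ | χ ≠ 1 ∧ ∀ g ∈ N, χ g = 1}

section Novikov

variable (R : Type u) {G : Type v} [Ring R] [Group G]

/-- The additive group underlying the Novikov ring of `R[G]` with respect to `χ`: formal series
`∑ r_g g`, i.e. functions `G → R`, such that for each `t` only finitely many `g` in the support
satisfy `χ(g) ≤ t`. -/
def novikov (χ : Character G) : AddSubgroup (G → R) where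
  carrier := {f | ∀ t : ℝ, {g : G | f g ≠ 0 ∧ (χ g).toAdd ≤ t}.Finite}
  zero_mem' := fun t => by simp
  add_mem' := by
    intro a b ha hb t
    refine ((ha t).union (hb t)).subset ?_
    rintro g ⟨hg, ht⟩
    by_cases h : a g = 0
    · right
      refine ⟨fun h' => hg ?_, ht⟩
      simp [h, h']
    · exact Or.inl ⟨h, ht⟩
  neg_mem' := by
    intro a ha t
    simpa using ha t

/-- Left multiplication of series by scalars: `r · ∑ r_g g = ∑ r r_g g`. -/
def novikovScalar (χ : Character G) : R →+* AddMonoid.End (novikov R χ) where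
  toFun r :=
    { toFun := fun f => ⟨fun h => r * f.1 h, fun t => (f.2 t).subset fun g hg =>
        ⟨fun h0 => hg.1 (by simp [h0]), hg.2⟩⟩
      map_zero' := by ext; simp
      map_add' := by intros; ext; simp [mul_add] }
  map_one' := AddMonoidHom.ext fun f => Subtype.ext (funext fun h => one_mul _)
  map_zero' := AddMonoidHom.ext fun f => Subtype.ext (funext fun h => zero_mul _)
  map_mul' _ _ := AddMonoidHom.ext fun f => Subtype.ext (funext fun h => mul_assoc _ _ _)
  map_add' _ _ := AddMonoidHom.ext fun f => Subtype.ext (funext fun h => add_mul _ _ _)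

/-- Left multiplication of series by group elements: `x · ∑ r_g g = ∑ r_g xg`; the coefficient at
`h` of the result is `r_{x⁻¹h}`. -/
def novikovTranslate (χ : Character G) : G →* AddMonoid.End (novikov R χ) where
  toFun x :=
    { toFun := fun f => ⟨fun h => f.1 (x⁻¹ * h), fun t => by
        refine ((f.2 (t - (χ x).toAdd)).image (x * ·)).subset ?_
        rintro g ⟨hg, ht⟩
        refine ⟨x⁻¹ * g, ⟨hg, ?_⟩, by simp⟩
        simp only [map_mul, map_inv, toAdd_mul, toAdd_inv]
        linarith⟩
      map_zero' := by ext; simp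
      map_add' := by intros; ext; simp }
  map_one' := AddMonoidHom.ext fun f => Subtype.ext (funext fun h => 
    show f.1 (1⁻¹ * h) = f.1 h by simp)
  map_mul' x y := AddMonoidHom.ext fun f => Subtype.ext (funext fun h => 
    show f.1 ((x * y)⁻¹ * h) = f.1 (y⁻¹ * (x⁻¹ * h)) by simp [mul_assoc])

theorem novikov_commute (χ : Character G) (r : R) (x : G) :
    Commute (novikovScalar R χ r) (novikovTranslate R χ x) :=
  AddMonoidHom.ext fun _ => rfl

/-- The ring homomorphism describing left multiplication of `R[G]` on its Novikov ring. -/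
def novikovAction (χ : Character G) : MonoidAlgebra R G →+* AddMonoid.End (novikov R χ) :=
  MonoidAlgebra.liftNCRingHom (novikovScalar R χ) (novikovTranslate R χ) (novikov_commute R χ)

instance (χ : Character G) : Module (MonoidAlgebra R G) (novikov R χ) :=
  Module.compHom (novikov R χ) (novikovAction R χ)

/-- The left `R[G]`-module structure is left multiplication: `(r g) · f` has coefficient
`r f(g⁻¹h)` at `h`. -/
theorem novikov_single_smul_apply (χ : Character G) (g h : G) (r : R) (f : novikov R χ) :
    (MonoidAlgebra.single g r • f).1 h = r * f.1 (g⁻¹ * h) := by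
  change (novikovAction R χ (MonoidAlgebra.single g r) f).1 h = _
  rw [novikovAction, MonoidAlgebra.liftNCRingHom_single]
  rfl

/-- The Novikov ring as a left `R[G]`-module (by left multiplication); this is the structure
that enters as coefficients in cohomology. -/
abbrev novikovModule (χ : Character G) : ModuleCat.{max u v} (MonoidAlgebra R G) :=
  ModuleCat.of (MonoidAlgebra R G) (novikov R χ)

/-- The invariant `Σ*_m(G; R)`: the non-zero characters `χ` with vanishing Novikov cohomology
`H^i(G; R[G]^χ)` in all degrees `i > cd_R(G) - m`. -/
def sigmaStar (G : Type v) [Group G] (m : ℕ) : Set (Character G) :=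
  {χ | χ ≠ 1 ∧ ∀ i : ℕ, cd R G < ((i + m : ℕ) : WithBot ℕ∞) →
    Subsingleton (groupCohom R G (novikovModule R χ) i)}

end Novikov

/-! ### Cohomology and cohomological dimension of chain complexes -/

section Complex

universe w w'

variable {A : Type w} [Ring A]

/-- The degree `i` cocycles of `Hom_A(C, M)`. -/
def cocycles (C : ChainComplex (ModuleCat.{w'} A) ℤ) (M : ModuleCat.{w'} A) (i : ℤ) :
    AddSubgroup (C.X i ⟶ M) where
  carrier := {f | C.d (i + 1) i ≫ f = 0}
  zero_mem' := by simp
  add_mem' := by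
    intro a b ha hb
    simp_all [Preadditive.comp_add]
  neg_mem' := by
    intro a ha
    simp_all [Preadditive.comp_neg]

/-- The degree `i` coboundaries of `Hom_A(C, M)`. -/
def coboundaries (C : ChainComplex (ModuleCat.{w'} A) ℤ) (M : ModuleCat.{w'} A) (i : ℤ) :
    AddSubgroup (C.X i ⟶ M) where
  carrier := {f | ∃ h : C.X (i - 1) ⟶ M, C.d i (i - 1) ≫ h = f}
  zero_mem' := ⟨0, by simp⟩
  add_mem' := by
    rintro _ _ ⟨a, rfl⟩ ⟨b, rfl⟩
    exact ⟨a + b, by simp [Preadditive.comp_add]⟩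
  neg_mem' := by
    rintro _ ⟨a, rfl⟩
    exact ⟨-a, by simp [Preadditive.comp_neg]⟩

/-- The cohomology `H^i(C; M)` of the cochain complex `Hom_A(C, M)`. -/
abbrev cohomology (C : ChainComplex (ModuleCat.{w'} A) ℤ) (M : ModuleCat.{w'} A) (i : ℤ) :
    Type w' :=
  cocycles C M i ⧸ (coboundaries C M i).addSubgroupOf (cocycles C M i)

/-- The cohomological dimension of a chain complex of `A`-modules: the supremum, among the extended
integers, of all `i` with `H^i(C; M) ≠ 0` for some `A`-module `M`
(it is `⊥` if there is no such `i`). -/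
def complexCd (C : ChainComplex (ModuleCat.{w'} A) ℤ) : WithBot (WithTop ℤ) :=
  sSup {k | ∃ i : ℤ, (∃ M : ModuleCat.{w'} A, Nontrivial (cohomology C M i)) ∧
    k = ((i : WithTop ℤ) : WithBot (WithTop ℤ))}

end Complex

/-- The restriction `res_N^G C` of a chain complex of `R[G]`-modules to `R[N]`. -/
def resComplex (R : Type u) {G : Type v} [Ring R] [Group G] (N : Subgroup G)
    (C : ChainComplex (ModuleCat.{max u v} (MonoidAlgebra R G)) ℤ) :
    ChainComplex (ModuleCat.{max u v} (MonoidAlgebra R N)) ℤ :=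
  ((ModuleCat.restrictScalars.{max u v}
    (MonoidAlgebra.mapDomainRingHom R N.subtype)).mapHomologicalComplex _).obj C

end CoAbelian

end

noncomputable section

set_option linter.unusedSectionVars false

namespace CoAbelian

universe w w'

/-! ### Functions on a group as a module over the group ring -/

/-! Let r be the rank of the quotient and m = n - r. By Shapiro's lemma, the cohomology of the
restricted complex with coefficients in A is that of the original complex with coefficients in the
coinduced module, realised as functions F on G with F (h * x) = x⁻¹ • F h. So the coinduced module
must be shown to have no cohomology above degree m.

For a finite set J of directions in ℝ^r, `coneModule` consists of the equivariant functions with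
support bounded below along every direction in J; J = ∅ gives the coinduced module. If J is nonempty
and close to a single v ≠ 0, cohomology vanishes above m. Indeed, Novikov vanishing at v yields, by
descending induction on degree, a homotopy from the identity to an endomorphism ε whose matrix is
supported in a finite set where the character of v is positive (`HasApproxContraction.of_add_one`).
Positivity on a finite set is an open condition, so it persists near v, and the Neumann series ∑ F ∘
ε^k turns cocycles into coboundaries.

Local vanishing is glued by Mayer–Vietoris: if q is the midpoint of a and b, the modules of {a, q} ∪
J and {b, q} ∪ J intersect in that of {a, b} ∪ J and add up to that of {q} ∪ J (`coneModule_inf`,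
`coneModule_sup`). Repeated bisection inside an open half-space gives vanishing in degrees at least
m + |J|. The antipodal pairs ± e_l, whose midpoint 0 imposes no condition, are then removed one by
one. With all r pairs present only degrees above m + r = n are needed, where the complex is
contractible; each removal gains a degree, and J = ∅ is reached with vanishing above m.

For groups, equality also needs cd(G) ≤ cd(N) + r. Between N and G lies a chain of subgroups with
successive quotients ℤ. Coinduction from the larger of two neighbours is the kernel of a surjective
difference operator on coinduction from the smaller, so each step costs one degree
(`CohomologyVanishes.flagSubgroup`). -/

/-- The functions `G → A`, regarded as an `R[G]`-module by left translation of functions. -/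
def TranslationModule (_R : Type u) (G : Type v) (A : Type w) : Type (max v w) := G → A

section TranslationModule

variable {R : Type u} {G : Type v} [Ring R] [Group G]
variable {A : Type w} [AddCommGroup A] [Module R A]

/-- An additive map between `R[G]`-modules which commutes with all monomials is linear. -/
def linearMapOfSingle {M : Type w} {M' : Type w'} [AddCommGroup M] [AddCommGroup M']
    [Module (MonoidAlgebra R G) M] [Module (MonoidAlgebra R G) M'] (f : M →+ M')
    (hf : ∀ (g : G) (r : R) (x : M),
      f (MonoidAlgebra.single g r • x) = MonoidAlgebra.single g r • f x) :
    M →ₗ[MonoidAlgebra R G] M' where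
  toFun := f
  map_add' := f.map_add
  map_smul' c x := by
    induction c using MonoidAlgebra.induction_linear with
    | zero => simp
    | add a b ha hb => simp_all [add_smul]
    | single g r => exact hf g r x

namespace TranslationModule

instance : AddCommGroup (TranslationModule R G A) := inferInstanceAs (AddCommGroup (G → A))

instance : CoeFun (TranslationModule R G A) fun _ => G → A := ⟨fun F => F⟩

@[ext] theorem ext {F F' : TranslationModule R G A} (h : ∀ g, F g = F' g) : F = F' := funext h

@[simp] theorem zero_apply (h : G) : (0 : TranslationModule R G A) h = 0 := rfl

@[simp] theorem neg_apply (F : TranslationModule R G A) (h : G) : (-F) h = -F h := rfl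

@[simp] theorem add_apply (F F' : TranslationModule R G A) (h : G) :
    (F + F') h = F h + F' h := rfl

@[simp] theorem sub_apply (F F' : TranslationModule R G A) (h : G) :
    (F - F') h = F h - F' h := rfl

/-- Evaluation at a group element. -/
def evalHom (h : G) : TranslationModule R G A →+ A where
  toFun F := F h
  map_zero' := rfl
  map_add' _ _ := rfl

@[simp] theorem sum_apply {ι : Type*} (s : Finset ι) (F : ι → TranslationModule R G A) (h : G) :
    (∑ i ∈ s, F i) h = ∑ i ∈ s, F i h :=
  map_sum (evalHom h) F s

/-- Scalars act on functions pointwise. -/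
def scalar : R →+* AddMonoid.End (TranslationModule R G A) where
  toFun r :=
    { toFun := fun F h => r • F h
      map_zero' := by ext; exact smul_zero r
      map_add' := by intros; ext; exact smul_add r _ _ }
  map_one' := AddMonoidHom.ext fun F => funext fun h => one_smul R (F h)
  map_zero' := AddMonoidHom.ext fun F => funext fun h => zero_smul R (F h)
  map_mul' _ _ := AddMonoidHom.ext fun F => funext fun h => mul_smul _ _ (F h)
  map_add' _ _ := AddMonoidHom.ext fun F => funext fun h => add_smul _ _ (F h)

/-- Group elements act on functions by left translation. -/
def translate : G →* AddMonoid.End (TranslationModule R G A) where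
  toFun x :=
    { toFun := fun F h => F (x⁻¹ * h)
      map_zero' := rfl
      map_add' := fun _ _ => rfl }
  map_one' := AddMonoidHom.ext fun F => funext fun h =>
    show F (1⁻¹ * h) = F h by simp
  map_mul' x y := AddMonoidHom.ext fun F => funext fun h =>
    show F ((x * y)⁻¹ * h) = F (y⁻¹ * (x⁻¹ * h)) by simp [mul_assoc]

theorem scalar_commute_translate (r : R) (x : G) :
    Commute (scalar (A := A) r) (translate (R := R) x) :=
  AddMonoidHom.ext fun _ => rfl

/-- The ring homomorphism describing the action of `R[G]` on functions. -/
def action : MonoidAlgebra R G →+* AddMonoid.End (TranslationModule R G A) :=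
  MonoidAlgebra.liftNCRingHom scalar translate scalar_commute_translate

instance : Module (MonoidAlgebra R G) (TranslationModule R G A) :=
  Module.compHom (TranslationModule R G A) (action (A := A))

@[simp] theorem single_smul_apply (g : G) (r : R) (F : TranslationModule R G A) (h : G) :
    (MonoidAlgebra.single g r • F) h = r • F (g⁻¹ * h) := by
  change (action (MonoidAlgebra.single g r) F) h = _
  rw [action, MonoidAlgebra.liftNCRingHom_single]
  rfl

theorem smul_apply (x : MonoidAlgebra R G) (F : TranslationModule R G A) (h : G) :
    (x • F) h = x.coeff.sum fun g r => r • F (g⁻¹ * h) := by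
  induction x using MonoidAlgebra.induction_linear with
  | zero => simp
  | add a b ha hb =>
    rw [add_smul, add_apply, ha, hb, MonoidAlgebra.coeff_add, Finsupp.sum_add_index']
    · intro g; exact zero_smul R _
    · intro g r s; exact add_smul r s _
  | single g r => simp [Finsupp.sum_single_index]

/-- The function `F` vanishes wherever the character `χ` takes a value less than `t`. -/
def Above (χ : Character G) (t : ℝ) (F : TranslationModule R G A) : Prop :=
  ∀ h, F h ≠ 0 → t ≤ (χ h).toAdd

variable {χ : Character G} {t t' : ℝ} {F F' : TranslationModule R G A}

theorem Above.mono (hF : Above χ t F) (h : t' ≤ t) : Above χ t' F := fun g hg => h.trans (hF g hg)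

theorem above_zero : Above χ t (0 : TranslationModule R G A) := fun _ h => (h rfl).elim

theorem Above.apply_eq_zero (hF : Above χ t F) {h : G} (hh : (χ h).toAdd < t) : F h = 0 := by
  by_contra h0
  exact absurd (hF h h0) (not_le.2 hh)

theorem Above.add (hF : Above χ t F) (hF' : Above χ t F') : Above χ t (F + F') := by
  intro h hh
  by_contra hlt
  rw [not_le] at hlt
  exact hh (by simp [hF.apply_eq_zero hlt, hF'.apply_eq_zero hlt])

theorem Above.neg (hF : Above χ t F) : Above χ t (-F) :=
  fun h hh => hF h fun h0 => hh (by simp [h0])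

theorem Above.sub (hF : Above χ t F) (hF' : Above χ t F') : Above χ t (F - F') := by
  rw [sub_eq_add_neg]
  exact hF.add hF'.neg

theorem Above.sum {ι : Type*} (s : Finset ι) {f : ι → TranslationModule R G A}
    (hf : ∀ i ∈ s, Above χ t (f i)) : Above χ t (∑ i ∈ s, f i) := by
  classical
  induction s using Finset.induction_on with
  | empty => simpa using above_zero
  | insert a s ha ih =>
    rw [Finset.sum_insert ha]
    exact (hf a (by simp)).add (ih fun i hi => hf i (by simp [hi]))

theorem Above.smul {δ : ℝ} {x : MonoidAlgebra R G} (hx : ∀ g ∈ x.coeff.support, δ ≤ (χ g).toAdd)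
    (hF : Above χ t F) : Above χ (t + δ) (x • F) := by
  intro h hh
  rw [smul_apply] at hh
  obtain ⟨g, hg, hg'⟩ := Finset.exists_ne_zero_of_sum_ne_zero hh
  have h1 := hx g hg
  have h2 := hF (g⁻¹ * h) fun h0 => hg' (by simp [h0])
  simp only [map_mul, map_inv, toAdd_mul, toAdd_inv] at h2
  linarith

theorem exists_le_of_finset (χ : Character G) (T : Finset G) :
    ∃ δ : ℝ, ∀ g ∈ T, δ ≤ (χ g).toAdd := by
  obtain ⟨δ, hδ⟩ := (T.image fun g => (χ g).toAdd).bddBelow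
  exact ⟨δ, fun g hg => hδ (by simpa using ⟨g, hg, rfl⟩)⟩

theorem Above.exists_smul (x : MonoidAlgebra R G) (hF : ∃ t, Above χ t F) :
    ∃ t, Above χ t (x • F) := by
  obtain ⟨t, ht⟩ := hF
  obtain ⟨δ, hδ⟩ := exists_le_of_finset χ x.coeff.support
  exact ⟨t + δ, ht.smul hδ⟩

variable (R A) in
/-- The functions whose support is bounded below with respect to the character `χ`. -/
def bounded (χ : Character G) : Submodule (MonoidAlgebra R G) (TranslationModule R G A) where
  carrier := {F | ∃ t, Above χ t F}
  zero_mem' := ⟨0, above_zero⟩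
  add_mem' := by
    rintro F F' ⟨t, ht⟩ ⟨t', ht'⟩
    exact ⟨min t t', (ht.mono (min_le_left _ _)).add (ht'.mono (min_le_right _ _))⟩
  smul_mem' x F hF := Above.exists_smul x hF

variable (R A) in
/-- The functions with finitely many support points in each sublevel set of `χ`. -/
def novikovSubmodule (χ : Character G) :
    Submodule (MonoidAlgebra R G) (TranslationModule R G A) where
  carrier := {F | ∀ t : ℝ, {g : G | F g ≠ 0 ∧ (χ g).toAdd ≤ t}.Finite}
  zero_mem' t := by simp
  add_mem' := by
    intro a b ha hb t
    refine ((ha t).union (hb t)).subset ?_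
    rintro g ⟨hg, ht⟩
    by_cases h : a g = 0
    · exact Or.inr ⟨fun h' => hg (by simp [h, h']), ht⟩
    · exact Or.inl ⟨h, ht⟩
  smul_mem' x F hF t := by
    refine (x.coeff.support.finite_toSet.biUnion fun g _ =>
      (hF (t - (χ g).toAdd)).image (g * ·)).subset ?_
    rintro h ⟨hh, ht⟩
    rw [smul_apply] at hh
    obtain ⟨g, hg, hg'⟩ := Finset.exists_ne_zero_of_sum_ne_zero hh
    simp only [Set.mem_iUnion]
    refine ⟨g, hg, g⁻¹ * h, ⟨fun h0 => hg' (by simp [h0]), ?_⟩, by simp⟩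
    simp only [map_mul, map_inv, toAdd_mul, toAdd_inv]
    linarith

/-- The inclusion of the Novikov ring into the functions on `G`. -/
def ofNovikov (χ : Character G) :
    novikov R χ →ₗ[MonoidAlgebra R G] TranslationModule R G R :=
  linearMapOfSingle
    { toFun := fun f => f.1
      map_zero' := rfl
      map_add' := fun _ _ => rfl }
    fun g r f => funext fun h => by
      rw [single_smul_apply]
      exact novikov_single_smul_apply R χ g h r f

theorem ofNovikov_injective (χ : Character G) : Function.Injective (ofNovikov (R := R) χ) :=
  fun _ _ h => Subtype.ext h

theorem ofNovikov_mem (χ : Character G) (f : novikov R χ) :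
    ofNovikov χ f ∈ novikovSubmodule R R χ := f.2

theorem exists_ofNovikov_comp {M : Type w'} [AddCommGroup M] [Module (MonoidAlgebra R G) M]
    (f : M →ₗ[MonoidAlgebra R G] TranslationModule R G R)
    (hf : ∀ x, f x ∈ novikovSubmodule R R χ) :
    ∃ f' : M →ₗ[MonoidAlgebra R G] novikov R χ, ofNovikov χ ∘ₗ f' = f :=
  ⟨{ toFun := fun x => ⟨f x, hf x⟩
     map_add' := fun x y => ofNovikov_injective χ (map_add f x y)
     map_smul' := fun c x => ofNovikov_injective χ ((map_smul f c x).trans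
      (map_smul (ofNovikov χ) c ⟨f x, hf x⟩).symm) }, rfl⟩

variable (R G) in
/-- The inclusion of the group ring into the functions on `G`. -/
def ofAlgebra : MonoidAlgebra R G →ₗ[MonoidAlgebra R G] TranslationModule R G R :=
  linearMapOfSingle
    { toFun := fun f h => f.coeff h
      map_zero' := rfl
      map_add' := fun _ _ => rfl }
    fun g r f => funext fun h => by
      rw [single_smul_apply]
      exact MonoidAlgebra.coeff_single_mul_apply f r g h

theorem ofAlgebra_apply (x : MonoidAlgebra R G) (h : G) : ofAlgebra R G x h = x.coeff h := rfl

theorem ofAlgebra_mem (χ : Character G) (x : MonoidAlgebra R G) :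
    ofAlgebra R G x ∈ novikovSubmodule R R χ := fun _ =>
  x.coeff.support.finite_toSet.subset fun g hg => by
    simpa [ofAlgebra_apply] using hg.1

theorem exists_above_of_mem_novikov (hF : F ∈ novikovSubmodule R A χ) : ∃ t, Above χ t F := by
  obtain ⟨δ, hδ⟩ := exists_le_of_finset χ (hF 0).toFinset
  refine ⟨min δ 0, fun h hh => ?_⟩
  by_cases h0 : (χ h).toAdd ≤ 0
  · exact (min_le_left _ _).trans (hδ h (by simp [hh, h0]))
  · exact (min_le_right _ _).trans (not_le.1 h0).le

end TranslationModule

end TranslationModule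

/-! ### Cohomology with coefficients in submodules -/

section Vanishing

variable {B : Type u} [Ring B] {X : ℤ → Type w} [∀ i, AddCommGroup (X i)] [∀ i, Module B (X i)]
variable {M : Type w'} [AddCommGroup M] [Module B M]

/-- Every degree `i` cocycle with values in the submodule `S` is the coboundary of a cochain with
values in `S`. -/
def CohomologyVanishes (d : ∀ i j, X i →ₗ[B] X j) (S : Submodule B M) (i : ℤ) : Prop :=
  ∀ f : X i →ₗ[B] M, (∀ x, f x ∈ S) → f ∘ₗ d (i + 1) i = 0 →
    ∃ h : X (i - 1) →ₗ[B] M, (∀ x, h x ∈ S) ∧ h ∘ₗ d i (i - 1) = f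

theorem CohomologyVanishes.exists_primitive {d : ∀ i j, X i →ₗ[B] X j} {S : Submodule B M}
    {i j : ℤ} (h : CohomologyVanishes d S i) (hj : j = i - 1) (f : X i →ₗ[B] M)
    (hf : ∀ x, f x ∈ S) (hf0 : f ∘ₗ d (i + 1) i = 0) :
    ∃ h : X j →ₗ[B] M, (∀ x, h x ∈ S) ∧ h ∘ₗ d i j = f := by
  subst hj
  exact h f hf hf0

/-- Projectivity is applied to the surjection from `S` onto its image under `p`, which keeps the
lift inside `S`. -/
theorem exists_lift_of_projective {P : Type w} [AddCommGroup P] [Module B P] [Module.Projective B P]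
    {M' : Type*} [AddCommGroup M'] [Module B M'] (p : M →ₗ[B] M') (S : Submodule B M)
    (f : P →ₗ[B] M') (hf : ∀ x, ∃ y ∈ S, p y = f x) :
    ∃ g : P →ₗ[B] M, (∀ x, g x ∈ S) ∧ p ∘ₗ g = f := by
  have hmem : ∀ x, f x ∈ S.map p := fun x => by simpa using hf x
  obtain ⟨g, hg⟩ := Module.projective_lifting_property (p.submoduleMap S) (f.codRestrict _ hmem)
    (p.submoduleMap_surjective S)
  refine ⟨S.subtype ∘ₗ g, fun x => (g x).2, LinearMap.ext fun x => ?_⟩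
  simpa using congrArg Subtype.val (LinearMap.congr_fun hg x)

/-- This is exactness of Hom(P, -) at the surjection S₁ ⊕ S₂ → S₁ + S₂, the input for
Mayer–Vietoris. -/
theorem exists_decomposition {P : Type w} [AddCommGroup P] [Module B P] [Module.Projective B P]
    {S₁ S₂ : Submodule B M} (f : P →ₗ[B] M) (hf : ∀ x, f x ∈ S₁ ⊔ S₂) :
    ∃ f₁ f₂ : P →ₗ[B] M, (∀ x, f₁ x ∈ S₁) ∧ (∀ x, f₂ x ∈ S₂) ∧ f₁ + f₂ = f := by
  obtain ⟨g, hg, hgf⟩ := exists_lift_of_projective (LinearMap.id.coprod LinearMap.id)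
    (S₁.prod S₂) f fun x => by
      obtain ⟨y, hy, z, hz, h⟩ := Submodule.mem_sup.1 (hf x)
      exact ⟨(y, z), ⟨hy, hz⟩, by simpa using h⟩
  refine ⟨LinearMap.fst B M M ∘ₗ g, LinearMap.snd B M M ∘ₗ g, fun x => (hg x).1, fun x => (hg x).2,
    ?_⟩
  rw [← hgf]
  ext x
  simp

variable {d : ∀ i j, X i →ₗ[B] X j} (hd : ∀ i j k, d j k ∘ₗ d i j = 0)
variable [∀ i, Module.Projective B (X i)]

include hd

/-- Mayer–Vietoris at H^{i-1}(S₁ + S₂) → H^i(S₁ ∩ S₂) → H^i(S₁) ⊕ H^i(S₂): the primitives of f in S₁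
and in S₂ differ by a cocycle of S₁ + S₂. -/
theorem CohomologyVanishes.inf {S₁ S₂ : Submodule B M} {i : ℤ} (h₁ : CohomologyVanishes d S₁ i)
    (h₂ : CohomologyVanishes d S₂ i) (h : CohomologyVanishes d (S₁ ⊔ S₂) (i - 1)) :
    CohomologyVanishes d (S₁ ⊓ S₂) i := by
  intro f hf hf0
  obtain ⟨k₁, hk₁, e₁⟩ := h₁ f (fun x => (hf x).1) hf0
  obtain ⟨k₂, hk₂, e₂⟩ := h₂ f (fun x => (hf x).2) hf0
  obtain ⟨l, hl, e⟩ := h (k₁ - k₂)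
    (fun x => sub_mem ((le_sup_left : S₁ ≤ _) (hk₁ x)) ((le_sup_right : S₂ ≤ _) (hk₂ x)))
    (by rw [sub_add_cancel, LinearMap.sub_comp, e₁, e₂, sub_self])
  obtain ⟨l₁, l₂, hl₁, hl₂, rfl⟩ := exists_decomposition l hl
  -- The two corrected primitives coincide, so their common value lies in both submodules.
  have key : k₁ - l₁ ∘ₗ d (i - 1) (i - 1 - 1) = k₂ + l₂ ∘ₗ d (i - 1) (i - 1 - 1) := by
    rw [LinearMap.add_comp] at e
    rw [sub_eq_iff_eq_add, add_assoc, add_comm (l₂ ∘ₗ _), e]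
    abel
  refine ⟨k₁ - l₁ ∘ₗ d (i - 1) (i - 1 - 1), fun x => ⟨sub_mem (hk₁ x) (hl₁ _), ?_⟩, ?_⟩
  · rw [key]
    exact add_mem (hk₂ x) (hl₂ _)
  · rw [LinearMap.sub_comp, LinearMap.comp_assoc, hd, e₁, LinearMap.comp_zero, sub_zero]

/-- Mayer–Vietoris at H^i(S₁) ⊕ H^i(S₂) → H^i(S₁ + S₂) → H^{i+1}(S₁ ∩ S₂): the obstruction to
splitting a cocycle into cocycles is the coboundary of one summand. -/
theorem CohomologyVanishes.sup {S₁ S₂ : Submodule B M} {i : ℤ} (h₁ : CohomologyVanishes d S₁ i)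
    (h₂ : CohomologyVanishes d S₂ i) (h : CohomologyVanishes d (S₁ ⊓ S₂) (i + 1)) :
    CohomologyVanishes d (S₁ ⊔ S₂) i := by
  intro f hf hf0
  obtain ⟨f₁, f₂, hf₁, hf₂, rfl⟩ := exists_decomposition f hf
  have e : f₁ ∘ₗ d (i + 1) i = -(f₂ ∘ₗ d (i + 1) i) := by
    rw [LinearMap.add_comp] at hf0
    exact eq_neg_of_add_eq_zero_left hf0
  obtain ⟨k, hk, ek⟩ := h.exists_primitive (add_sub_cancel_right i 1).symm (f₁ ∘ₗ d (i + 1) i)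
    (fun x => ⟨hf₁ _, by rw [e]; exact neg_mem (hf₂ _)⟩)
    (by rw [LinearMap.comp_assoc, hd, LinearMap.comp_zero])
  obtain ⟨l₁, hl₁, e₁⟩ := h₁ (f₁ - k) (fun x => sub_mem (hf₁ x) (hk x).1)
    (by rw [LinearMap.sub_comp, ek, sub_self])
  obtain ⟨l₂, hl₂, e₂⟩ := h₂ (f₂ + k) (fun x => add_mem (hf₂ x) (hk x).2)
    (by rw [LinearMap.add_comp, ek, e, add_neg_cancel])
  refine ⟨l₁ + l₂, fun x => add_mem ((le_sup_left : S₁ ≤ _) (hl₁ x))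
    ((le_sup_right : S₂ ≤ _) (hl₂ x)), ?_⟩
  rw [LinearMap.add_comp, e₁, e₂]
  abel

/-- If `D` maps `S` onto itself, the vanishing of cohomology passes from `S` to the kernel of `D` on
`S`, with a loss of one degree. -/
theorem CohomologyVanishes.ker {S : Submodule B M} {i : ℤ} (D : M →ₗ[B] M)
    (hD : ∀ x ∈ S, D x ∈ S) (hD' : ∀ x ∈ S, ∃ y ∈ S, D y = x)
    (h₁ : CohomologyVanishes d S i) (h₂ : CohomologyVanishes d S (i - 1)) :
    CohomologyVanishes d (S ⊓ LinearMap.ker D) i := by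
  intro f hf hf0
  obtain ⟨k, hk, rfl⟩ := h₁ f (fun x => (hf x).1) hf0
  obtain ⟨l, hl, e⟩ := h₂ (D ∘ₗ k) (fun x => hD _ (hk x)) (by
    rw [sub_add_cancel]
    ext x
    exact (hf x).2)
  -- Lifting the primitive of D ∘ k through D lets k be corrected by the coboundary of m: its own
  -- coboundary is unchanged and D now kills it.
  obtain ⟨m, hm, rfl⟩ := exists_lift_of_projective D S l fun x => hD' _ (hl x)
  refine ⟨k - m ∘ₗ d (i - 1) (i - 1 - 1), fun x => ⟨sub_mem (hk x) (hm _), ?_⟩, ?_⟩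
  · have := LinearMap.congr_fun e x
    simp only [LinearMap.comp_apply] at this
    simp [this]
  · rw [LinearMap.sub_comp, LinearMap.comp_assoc, hd, LinearMap.comp_zero, sub_zero]

end Vanishing

open TranslationModule

/-! ### Neumann series -/

section Neumann

variable {R : Type u} {G : Type v} [Ring R] [Group G]
variable {A : Type w'} [AddCommGroup A] [Module R A]
variable {P : Type w} [AddCommGroup P] [Module (MonoidAlgebra R G) P]

/-- With respect to some finite generating family, the endomorphism `ε` is given by a matrix over
`R[G]` whose entries are supported in `T`. -/
def IsSupportedIn (T : Finset G) (ε : P →ₗ[MonoidAlgebra R G] P) : Prop :=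
  ∃ (k : ℕ) (x : Fin k → P) (c : Fin k → Fin k → MonoidAlgebra R G),
    Submodule.span (MonoidAlgebra R G) (Set.range x) = ⊤ ∧
    (∀ a, ε (x a) = ∑ b, c a b • x b) ∧ ∀ a b, (c a b).coeff.support ⊆ T

/-- `g` is the pointwise sum of the series `∑ F ∘ ε ^ k`. -/
def IsNeumannSum (F : P →ₗ[MonoidAlgebra R G] TranslationModule R G A)
    (ε : P →ₗ[MonoidAlgebra R G] P) (g : P →ₗ[MonoidAlgebra R G] TranslationModule R G A) : Prop :=
  ∀ p h, ∃ K, ∀ K' ≥ K, F ((ε ^ K') p) h = 0 ∧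
    g p h = ∑ k ∈ Finset.range K', F ((ε ^ k) p) h

variable {F : P →ₗ[MonoidAlgebra R G] TranslationModule R G A}
  {ε : P →ₗ[MonoidAlgebra R G] P} {g : P →ₗ[MonoidAlgebra R G] TranslationModule R G A}

/-- At every point only finitely many terms survive, so linearity can be checked on a common finite
partial sum. -/
theorem exists_isNeumannSum (hF : ∀ p h, ∃ K, ∀ k ≥ K, F ((ε ^ k) p) h = 0) :
    ∃ g, IsNeumannSum F ε g := by
  have hsum : ∀ p h, ∃ K, ∀ K' ≥ K,
      ∑ᶠ k, F ((ε ^ k) p) h = ∑ k ∈ Finset.range K', F ((ε ^ k) p) h := by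
    intro p h
    obtain ⟨K, hK⟩ := hF p h
    refine ⟨K, fun K' hK' => finsum_eq_sum_of_support_subset _ fun k hk => ?_⟩
    by_contra hk'
    simp only [Finset.coe_range, Set.mem_Iio, not_lt] at hk'
    exact hk (hK k (hK'.trans hk'))
  refine ⟨linearMapOfSingle
    { toFun := fun p h => ∑ᶠ k, F ((ε ^ k) p) h
      map_zero' := ?_
      map_add' := ?_ } ?_, fun p h => ?_⟩
  · ext h
    simp
  · intro p q
    ext h
    obtain ⟨K₁, h₁⟩ := hsum p h
    obtain ⟨K₂, h₂⟩ := hsum q h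
    obtain ⟨K₃, h₃⟩ := hsum (p + q) h
    set K := max K₁ (max K₂ K₃)
    change (∑ᶠ k, F ((ε ^ k) (p + q)) h) = (∑ᶠ k, F ((ε ^ k) p) h) + ∑ᶠ k, F ((ε ^ k) q) h
    rw [h₁ K (by simp [K]), h₂ K (by simp [K]), h₃ K (by simp [K]), ← Finset.sum_add_distrib]
    simp
  · intro x r p
    ext h
    obtain ⟨K₁, h₁⟩ := hsum (MonoidAlgebra.single x r • p) h
    obtain ⟨K₂, h₂⟩ := hsum p (x⁻¹ * h)
    set K := max K₁ K₂
    rw [single_smul_apply]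
    change (∑ᶠ k, F ((ε ^ k) (MonoidAlgebra.single x r • p)) h) =
      r • ∑ᶠ k, F ((ε ^ k) p) (x⁻¹ * h)
    rw [h₁ K (by simp [K]), h₂ K (by simp [K]), Finset.smul_sum]
    simp
  · obtain ⟨K₁, h₁⟩ := hsum p h
    obtain ⟨K₂, h₂⟩ := hF p h
    exact ⟨max K₁ K₂, fun K' hK' => ⟨h₂ K' ((le_max_right _ _).trans hK'),
      h₁ K' ((le_max_left _ _).trans hK')⟩⟩

theorem IsNeumannSum.apply_sub (hg : IsNeumannSum F ε g) (p : P) : g p - g (ε p) = F p := by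
  ext h
  obtain ⟨K₁, h₁⟩ := hg p h
  obtain ⟨K₂, h₂⟩ := hg (ε p) h
  -- One more term is taken for p than for ε p, so that the two partial sums telescope.
  have e₁ := (h₁ (max K₁ K₂ + 1) (by omega)).2
  have e₂ := (h₂ (max K₁ K₂) (by omega)).2
  rw [Finset.sum_range_succ'] at e₁
  simp only [pow_succ, Module.End.mul_apply] at e₁
  rw [TranslationModule.sub_apply, e₁, e₂]
  simp

theorem IsNeumannSum.above_sub {χ : Character G} {B : ℝ} (hg : IsNeumannSum F ε g) {p : P} {K : ℕ}
    (hK : ∀ k ≥ K, Above χ B (F ((ε ^ k) p))) :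
    Above χ B (g p - ∑ k ∈ Finset.range K, F ((ε ^ k) p)) := by
  intro h hh
  by_contra hlt
  rw [not_le] at hlt
  obtain ⟨K₁, h₁⟩ := hg p h
  refine hh ?_
  rw [TranslationModule.sub_apply, TranslationModule.sum_apply, (h₁ (max K₁ K) (by omega)).2,
    sub_eq_zero]
  refine (Finset.sum_subset (Finset.range_mono (le_max_right _ _)) fun k _ hk => ?_).symm
  exact (hK k (by simpa using hk)).apply_eq_zero hlt

theorem IsNeumannSum.above {χ : Character G} {B : ℝ} (hg : IsNeumannSum F ε g) {p : P}
    (hK : ∀ k, Above χ B (F ((ε ^ k) p))) : Above χ B (g p) := by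
  simpa using hg.above_sub (K := 0) fun k _ => hK k

theorem IsNeumannSum.eq_zero (hg : IsNeumannSum F ε g) {p : P}
    (hp : ∀ k, F ((ε ^ k) p) = 0) : g p = 0 := by
  ext h
  obtain ⟨K₁, h₁⟩ := hg p h
  rw [(h₁ K₁ le_rfl).2]
  simp [hp]

theorem exists_pos_le_of_finset (χ : Character G) (T : Finset G) (hT : ∀ g ∈ T, 0 < (χ g).toAdd) :
    ∃ δ > 0, ∀ g ∈ T, δ ≤ (χ g).toAdd := by
  classical
  induction T using Finset.induction_on with
  | empty => exact ⟨1, one_pos, by simp⟩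
  | insert a s ha ih =>
    obtain ⟨δ, hδ, h⟩ := ih fun g hg => hT g (by simp [hg])
    refine ⟨min δ (χ a).toAdd, lt_min hδ (hT a (by simp)), fun g hg => ?_⟩
    rcases Finset.mem_insert.1 hg with rfl | hg
    · exact min_le_right _ _
    · exact (min_le_left _ _).trans (h g hg)

/-- If `ε` is supported in a set on which `χ` is positive, the terms `F ∘ ε ^ k` are supported at
heights that grow linearly. -/
theorem IsSupportedIn.exists_above {T : Finset G} (hε : IsSupportedIn T ε) {χ : Character G}
    (hT : ∀ g ∈ T, 0 < (χ g).toAdd) (hF : ∀ p, F p ∈ bounded R A χ) :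
    ∃ δ > 0, ∀ p, ∃ t, ∀ k : ℕ, Above χ (t + k * δ) (F ((ε ^ k) p)) := by
  obtain ⟨n, x, c, hx, hc, hcT⟩ := hε
  obtain ⟨δ, hδ, hδT⟩ := exists_pos_le_of_finset χ T hT
  refine ⟨δ, hδ, ?_⟩
  choose τ hτ using fun a => hF (x a)
  obtain ⟨t, ht⟩ : ∃ t, ∀ a, t ≤ τ a := by
    obtain ⟨t, ht⟩ := (Set.finite_range τ).bddBelow
    exact ⟨t, fun a => ht ⟨a, rfl⟩⟩
  -- On the generators each application of ε raises the height by at least δ. For general p only the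
  -- starting height t changes.
  have key : ∀ (k : ℕ) (a : Fin n), Above χ (t + k * δ) (F ((ε ^ k) (x a))) := by
    intro k
    induction k with
    | zero => intro a; simpa using (hτ a).mono (ht a)
    | succ k ih =>
      intro a
      rw [pow_succ, Module.End.mul_apply, hc]
      simp only [map_sum, map_smul]
      refine Above.sum _ fun b _ => ?_
      have := (ih b).smul fun g hg => hδT g (hcT a b hg)
      convert this using 1
      push_cast
      ring
  intro p
  have hp : p ∈ Submodule.span (MonoidAlgebra R G) (Set.range x) := hx ▸ Submodule.mem_top
  induction hp using Submodule.span_induction with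
  | mem p hp =>
    obtain ⟨a, rfl⟩ := hp
    exact ⟨t, fun k => key k a⟩
  | zero => exact ⟨0, fun k => by simpa using above_zero⟩
  | add p q _ _ hp hq =>
    obtain ⟨t₁, h₁⟩ := hp
    obtain ⟨t₂, h₂⟩ := hq
    refine ⟨min t₁ t₂, fun k => ?_⟩
    rw [map_add, map_add]
    exact ((h₁ k).mono (by gcongr; exact min_le_left _ _)).add
      ((h₂ k).mono (by gcongr; exact min_le_right _ _))
  | smul r p _ hp =>
    obtain ⟨t₁, h₁⟩ := hp
    obtain ⟨e, he⟩ := exists_le_of_finset χ r.coeff.support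
    refine ⟨t₁ + e, fun k => ?_⟩
    rw [map_smul, map_smul]
    exact ((h₁ k).smul he).mono (by linarith)

theorem IsSupportedIn.eventually_above {T : Finset G} (hε : IsSupportedIn T ε) {χ : Character G}
    (hT : ∀ g ∈ T, 0 < (χ g).toAdd) (hF : ∀ p, F p ∈ bounded R A χ) (p : P) (B : ℝ) :
    ∃ K : ℕ, ∀ k ≥ K, Above χ B (F ((ε ^ k) p)) := by
  obtain ⟨δ, hδ, h⟩ := hε.exists_above hT hF
  obtain ⟨t, ht⟩ := h p
  obtain ⟨K, hK⟩ := exists_nat_ge ((B - t) / δ)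
  refine ⟨K, fun k hk => (ht k).mono ?_⟩
  have : (B - t) / δ ≤ k := hK.trans (by exact_mod_cast hk)
  rw [div_le_iff₀ hδ] at this
  linarith

theorem IsSupportedIn.exists_isNeumannSum {T : Finset G} (hε : IsSupportedIn T ε)
    {χ : Character G} (hT : ∀ g ∈ T, 0 < (χ g).toAdd) (hF : ∀ p, F p ∈ bounded R A χ) :
    ∃ g, IsNeumannSum F ε g := by
  refine CoAbelian.exists_isNeumannSum fun p h => ?_
  obtain ⟨K, hK⟩ := hε.eventually_above hT hF p ((χ h).toAdd + 1)
  exact ⟨K, fun k hk => (hK k hk).apply_eq_zero (by linarith)⟩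

theorem IsNeumannSum.mem_bounded (hg : IsNeumannSum F ε g) {T : Finset G}
    (hε : IsSupportedIn T ε) {χ : Character G} (hT : ∀ g ∈ T, 0 < (χ g).toAdd)
    (hF : ∀ p, F p ∈ bounded R A χ) (p : P) : g p ∈ bounded R A χ := by
  obtain ⟨δ, hδ, h⟩ := hε.exists_above hT hF
  obtain ⟨t, ht⟩ := h p
  exact ⟨t, hg.above fun k => (ht k).mono (by nlinarith [Nat.cast_nonneg (α := ℝ) k])⟩

/-- Up to any given height the series agrees with a finite partial sum, which is a Novikov element.
-/
theorem IsNeumannSum.mem_novikov (hg : IsNeumannSum F ε g) {T : Finset G}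
    (hε : IsSupportedIn T ε) {χ : Character G} (hT : ∀ g ∈ T, 0 < (χ g).toAdd)
    (hF : ∀ p, F p ∈ novikovSubmodule R A χ) (p : P) : g p ∈ novikovSubmodule R A χ := by
  intro t
  obtain ⟨K, hK⟩ := hε.eventually_above hT (fun p => exists_above_of_mem_novikov (hF p)) p (t + 1)
  have h1 : ∑ k ∈ Finset.range K, F ((ε ^ k) p) ∈ novikovSubmodule R A χ :=
    sum_mem fun k _ => hF _
  refine (h1 t).subset ?_
  rintro h ⟨hh, ht⟩
  refine ⟨fun h0 => hh ?_, ht⟩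
  have := (hg.above_sub hK).apply_eq_zero (h := h) (by linarith)
  rw [TranslationModule.sub_apply, h0, sub_zero] at this
  exact this

end Neumann

/-! ### Approximate contractions -/

section Contraction

variable {R : Type u} {G : Type v} [Ring R] [Group G]
variable {A : Type w'} [AddCommGroup A] [Module R A]
variable {X : ℤ → Type w} [∀ i, AddCommGroup (X i)] [∀ i, Module (MonoidAlgebra R G) (X i)]

/-- Near degree `i`, the identity is homotopic to an endomorphism supported in `T`. -/
def HasApproxContraction (d : ∀ i j, X i →ₗ[MonoidAlgebra R G] X j) (T : Finset G) (i : ℤ) :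
    Prop :=
  ∃ (s : X i →ₗ[MonoidAlgebra R G] X (i + 1)) (s' : X (i - 1) →ₗ[MonoidAlgebra R G] X i),
    IsSupportedIn T (LinearMap.id - d (i + 1) i ∘ₗ s - s' ∘ₗ d i (i - 1))

variable {d : ∀ i j, X i →ₗ[MonoidAlgebra R G] X j} (hd : ∀ i j k, d j k ∘ₗ d i j = 0)

include hd

/-- F kills boundaries and ε preserves them, so g kills them too. The term g ∘ d ∘ s then disappears
from F = g ∘ (id - ε). -/
theorem IsNeumannSum.eq_comp {i j k : ℤ} {s : X i →ₗ[MonoidAlgebra R G] X j}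
    {s' : X k →ₗ[MonoidAlgebra R G] X i}
    {F g : X i →ₗ[MonoidAlgebra R G] TranslationModule R G A}
    (hg : IsNeumannSum F (LinearMap.id - d j i ∘ₗ s - s' ∘ₗ d i k) g) (hF : F ∘ₗ d j i = 0) :
    (g ∘ₗ s') ∘ₗ d i k = F := by
  set ε := LinearMap.id - d j i ∘ₗ s - s' ∘ₗ d i k with hε
  have h0 : ∀ (n : ℕ) y, F ((ε ^ n) (d j i y)) = 0 := by
    intro n
    induction n with
    | zero => intro y; simpa using LinearMap.congr_fun hF y
    | succ n ih =>
      intro y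
      rw [pow_succ, Module.End.mul_apply]
      have : ε (d j i y) = d j i (y - s (d j i y)) := by
        have := LinearMap.congr_fun (hd j i k) y
        simp only [LinearMap.comp_apply, LinearMap.zero_apply] at this
        simp [hε, this]
      rw [this]
      exact ih _
  ext1 x
  have h1 : g (d j i (s x)) = 0 := hg.eq_zero fun n => h0 n _
  rw [← hg.apply_sub x]
  simp [hε, h1]

end Contraction

/-! ### Existence of approximate contractions -/

section Truncation

variable {R : Type u} {G : Type v} [Ring R] [Group G] {χ : Character G}

theorem exists_truncation {F : TranslationModule R G R} (hF : F ∈ novikovSubmodule R R χ) (L : ℝ) :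
    ∃ x : MonoidAlgebra R G, Above χ L (ofAlgebra R G x - F) := by
  classical
  refine ⟨.ofCoeff (Finsupp.onFinset (hF L).toFinset
    (fun g => if (χ g).toAdd ≤ L then F g else 0) fun g hg => ?_), fun h hh => ?_⟩
  · simp only [ne_eq, ite_eq_right_iff, Classical.not_imp] at hg
    simpa using ⟨hg.2, hg.1⟩
  · by_contra hlt
    rw [not_le] at hlt
    refine hh ?_
    rw [TranslationModule.sub_apply, ofAlgebra_apply]
    simp [hlt.le]

/-- A map from a projective module to a Novikov ring agrees on a finite family of elements with a
map to the group ring, up to an error supported at an arbitrarily large height. -/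
theorem exists_linearMap_truncation {P : Type w} [AddCommGroup P] [Module (MonoidAlgebra R G) P]
    [Module.Projective (MonoidAlgebra R G) P]
    (t : P →ₗ[MonoidAlgebra R G] TranslationModule R G R)
    (ht : ∀ p, t p ∈ novikovSubmodule R R χ) {k : ℕ} (y : Fin k → P) (B : ℝ) :
    ∃ t' : P →ₗ[MonoidAlgebra R G] MonoidAlgebra R G,
      ∀ a, Above χ B (ofAlgebra R G (t' (y a)) - t (y a)) := by
  -- P is a summand of the free module on its own elements, and truncation at height L is prescribed
  -- on that basis. The finitely many `y a` involve finitely many basis vectors, so one large L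
  -- works for all of them.
  obtain ⟨σ, hσ⟩ := Module.projective_def.1 ‹Module.Projective (MonoidAlgebra R G) P›
  choose low hlow using fun (L : ℝ) p => exists_truncation (ht p) L
  have key : ∀ a, ∀ᶠ L in Filter.atTop, Above χ B (ofAlgebra R G
      (Finsupp.linearCombination _ (low L) (σ (y a))) - t (y a)) := by
    intro a
    have h1 : ∀ p ∈ (σ (y a)).support, ∀ᶠ L in Filter.atTop,
        Above χ B ((σ (y a) p) • (ofAlgebra R G (low L p) - t p)) := by
      intro p _
      obtain ⟨e, he⟩ := exists_le_of_finset χ (σ (y a) p).coeff.support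
      filter_upwards [Filter.eventually_ge_atTop (B - e)] with L hL
      exact ((hlow L p).smul he).mono (by linarith)
    filter_upwards [(Filter.eventually_all_finset _).2 h1] with L hL
    have h2 : t (y a) = (σ (y a)).sum fun p c => c • t p := by
      conv_lhs => rw [← hσ (y a)]
      simp [Finsupp.linearCombination_apply, map_finsuppSum]
    rw [h2, Finsupp.linearCombination_apply, Finsupp.sum, Finsupp.sum, map_sum,
      ← Finset.sum_sub_distrib]
    refine Above.sum _ fun p hp => ?_
    rw [map_smul, ← smul_sub]
    exact hL p hp
  obtain ⟨L, hL⟩ := (Filter.eventually_all.2 key).exists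
  exact ⟨Finsupp.linearCombination _ (low L) ∘ₗ σ, hL⟩

end Truncation

section Contraction

variable {R : Type u} {G : Type v} [Ring R] [Group G] {χ : Character G}
variable {X : ℤ → Type w} [∀ i, AddCommGroup (X i)] [∀ i, Module (MonoidAlgebra R G) (X i)]
variable {d : ∀ i j, X i →ₗ[MonoidAlgebra R G] X j} (hd : ∀ i j k, d j k ∘ₗ d i j = 0)
variable [∀ i, Module.Projective (MonoidAlgebra R G) (X i)]

include hd

/-- Over the Novikov ring each coordinate of the section ι of π equals g ∘ s' + t ∘ d: here g is the
Neumann series of its coboundary and t comes from Novikov vanishing in degree i. Cutting g after K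
terms and t at a finite height returns to R[G], with errors on the generators of height at least 1.
Only X i is assumed finitely generated, so t on X (i - 1) is truncated using projectivity. -/
theorem HasApproxContraction.of_add_one {i j k : ℤ} (hj : j = i + 1) (hk : k = j + 1)
    [Module.Finite (MonoidAlgebra R G) (X i)]
    {T : Finset G} (hT : ∀ g ∈ T, 0 < (χ g).toAdd)
    {s : X j →ₗ[MonoidAlgebra R G] X k} {s' : X i →ₗ[MonoidAlgebra R G] X j}
    (hs : IsSupportedIn T (LinearMap.id - d k j ∘ₗ s - s' ∘ₗ d j i))
    (hv : ∀ f : X i →ₗ[MonoidAlgebra R G] novikov R χ, f ∘ₗ d (i + 1) i = 0 →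
      ∃ h : X (i - 1) →ₗ[MonoidAlgebra R G] novikov R χ, h ∘ₗ d i (i - 1) = f) :
    ∃ T' : Finset G, (∀ g ∈ T', 0 < (χ g).toAdd) ∧ HasApproxContraction d T' i := by
  classical
  subst hj
  set ε := LinearMap.id - d k (i + 1) ∘ₗ s - s' ∘ₗ d (i + 1) i with hε
  obtain ⟨n, π, hπ⟩ := Module.Finite.exists_fin' (MonoidAlgebra R G) (X i)
  obtain ⟨ι, hι⟩ := Module.projective_lifting_property π LinearMap.id hπ
  set x : Fin n → X i := fun a => π (Pi.single a 1) with hx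
  have hπx : ∀ w, π w = ∑ a, w a • x a := by
    intro w
    conv_lhs => rw [pi_eq_sum_univ' w]
    simp [hx, map_sum]
  let F : Fin n → X (i + 1) →ₗ[MonoidAlgebra R G] TranslationModule R G R := fun a =>
    ofAlgebra R G ∘ₗ LinearMap.proj a ∘ₗ ι ∘ₗ d (i + 1) i
  have hFN : ∀ a p, F a p ∈ novikovSubmodule R R χ := fun a p => ofAlgebra_mem χ _
  have hFb : ∀ a p, F a p ∈ bounded R R χ := fun a p => exists_above_of_mem_novikov (hFN a p)
  choose g hg using fun a => hs.exists_isNeumannSum hT (hFb a)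
  have hgF : ∀ a, (g a ∘ₗ s') ∘ₗ d (i + 1) i = F a := by
    intro a
    refine (hg a).eq_comp hd ?_
    simp only [F, LinearMap.comp_assoc, hd, LinearMap.comp_zero]
  -- By `hgF` the right-hand side is a cocycle with Novikov values, hence a coboundary.
  have hex : ∀ a, ∃ t : X (i - 1) →ₗ[MonoidAlgebra R G] TranslationModule R G R,
      (∀ p, t p ∈ novikovSubmodule R R χ) ∧
      t ∘ₗ d i (i - 1) = ofAlgebra R G ∘ₗ LinearMap.proj a ∘ₗ ι - g a ∘ₗ s' := by
    intro a
    obtain ⟨f, hf⟩ := exists_ofNovikov_comp (χ := χ)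
      (ofAlgebra R G ∘ₗ LinearMap.proj a ∘ₗ ι - g a ∘ₗ s')
      (fun p => sub_mem (ofAlgebra_mem χ _) ((hg a).mem_novikov hs hT (hFN a) _))
    obtain ⟨h, hh⟩ := hv f (by
      ext1 y
      refine ofNovikov_injective χ ?_
      rw [LinearMap.comp_apply, ← LinearMap.comp_apply (ofNovikov χ), hf]
      have := LinearMap.congr_fun (hgF a) y
      simp only [LinearMap.comp_apply, F] at this
      simp [this])
    refine ⟨ofNovikov χ ∘ₗ h, fun p => ofNovikov_mem χ _, ?_⟩
    rw [LinearMap.comp_assoc, hh, hf]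
  choose t htN ht using hex
  choose t' ht' using fun a =>
    exists_linearMap_truncation (t a) (htN a) (fun b => d i (i - 1) (x b)) 1
  have hK : ∃ K : ℕ, ∀ a b, ∀ k ≥ K, Above χ 1 (F a ((ε ^ k) (s' (x b)))) := by
    choose K hK using fun a b => hs.eventually_above hT (hFb a) (s' (x b)) 1
    refine ⟨Finset.univ.sup fun a => Finset.univ.sup fun b => K a b, fun a b k hk =>
      hK a b k (le_trans ?_ hk)⟩
    exact (Finset.le_sup (f := fun b => K a b) (Finset.mem_univ b)).trans
      (Finset.le_sup (f := fun a => Finset.univ.sup fun b => K a b) (Finset.mem_univ a))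
  obtain ⟨K, hK⟩ := hK
  let σ : X i →ₗ[MonoidAlgebra R G] X (i + 1) := (∑ k ∈ Finset.range K, ε ^ k) ∘ₗ s'
  -- The vector `c b` is a preimage under π of the new error endomorphism evaluated at `x b`.
  let c : Fin n → Fin n → MonoidAlgebra R G := fun b a =>
    ι (x b - d (i + 1) i (σ (x b))) a - t' a (d i (i - 1) (x b))
  have hc : ∀ b a, Above χ 1 (ofAlgebra R G (c b a)) := by
    intro b a
    have e1 := LinearMap.congr_fun (ht a) (x b)
    have e2 : ofAlgebra R G (ι (d (i + 1) i (σ (x b))) a) =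
        ∑ k ∈ Finset.range K, F a ((ε ^ k) (s' (x b))) := by
      simp [F, σ, map_sum]
    have e3 : ofAlgebra R G (c b a) =
        (g a (s' (x b)) - ∑ k ∈ Finset.range K, F a ((ε ^ k) (s' (x b)))) -
        (ofAlgebra R G (t' a (d i (i - 1) (x b))) - t a (d i (i - 1) (x b))) := by
      simp only [LinearMap.comp_apply, LinearMap.sub_apply, LinearMap.proj_apply] at e1
      rw [e1]
      simp only [c, map_sub, Pi.sub_apply, e2]
      abel
    rw [e3]
    exact ((hg a).above_sub (hK a b)).sub (ht' a b)
  refine ⟨Finset.univ.biUnion fun b => Finset.univ.biUnion fun a => (c b a).coeff.support,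
    fun y hy => ?_, σ, π ∘ₗ LinearMap.pi t', n, x, c, ?_, fun b => ?_, fun b a => ?_⟩
  · simp only [Finset.mem_biUnion, Finset.mem_univ, true_and] at hy
    obtain ⟨b, a, hy⟩ := hy
    exact one_pos.trans_le (hc b a y (by simpa [ofAlgebra_apply] using hy))
  · rw [eq_top_iff]
    intro p _
    obtain ⟨w, rfl⟩ := hπ p
    rw [hπx]
    exact sum_mem fun a _ => Submodule.smul_mem _ _ (Submodule.subset_span ⟨a, rfl⟩)
  · have : π (ι (x b - d (i + 1) i (σ (x b)))) = x b - d (i + 1) i (σ (x b)) :=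
      LinearMap.congr_fun hι _
    rw [← hπx (c b)]
    have hcb : c b = ι (x b - d (i + 1) i (σ (x b))) - LinearMap.pi t' (d i (i - 1) (x b)) := rfl
    rw [hcb, map_sub, this]
    simp
  · exact (Finset.subset_biUnion_of_mem (fun a => (c b a).coeff.support) (Finset.mem_univ a)).trans
      (Finset.subset_biUnion_of_mem
        (fun b => Finset.univ.biUnion fun a => (c b a).coeff.support) (Finset.mem_univ b))

end Contraction

/-! ### Exact contractions -/

section ExactContraction

variable {B : Type u} [Ring B] {X : ℤ → Type w} [∀ i, AddCommGroup (X i)] [∀ i, Module B (X i)]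

/-- Near degree `i`, the identity is null-homotopic. -/
def HasContraction (d : ∀ i j, X i →ₗ[B] X j) (i : ℤ) : Prop :=
  ∃ (s : X i →ₗ[B] X (i + 1)) (s' : X (i - 1) →ₗ[B] X i),
    LinearMap.id - d (i + 1) i ∘ₗ s - s' ∘ₗ d i (i - 1) = 0

variable {d : ∀ i j, X i →ₗ[B] X j}

theorem HasContraction.of_subsingleton {i : ℤ} [Subsingleton (X i)] : HasContraction d i :=
  ⟨0, 0, Subsingleton.elim _ _⟩

theorem HasContraction.cohomologyVanishes {i : ℤ} (h : HasContraction d i) {M : Type w'}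
    [AddCommGroup M] [Module B M] (S : Submodule B M) : CohomologyVanishes d S i := by
  intro f hf hf0
  obtain ⟨s, s', hs⟩ := h
  refine ⟨f ∘ₗ s', fun x => hf _, LinearMap.ext fun x => ?_⟩
  have h1 := congrArg f (LinearMap.congr_fun hs x)
  have h2 := LinearMap.congr_fun hf0 (s x)
  simp only [LinearMap.comp_apply, LinearMap.zero_apply] at h2
  simp only [LinearMap.sub_apply, LinearMap.comp_apply, LinearMap.id_apply, map_sub, h2,
    LinearMap.zero_apply, map_zero, sub_zero] at h1
  exact (sub_eq_zero.1 h1).symm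

/-- The projection onto X i / im d is the universal cocycle. A primitive of it lifts to s'; then id
- s' ∘ d takes values in im d and lifts through d to s. -/
theorem HasContraction.of_vanishing [∀ i, Module.Projective B (X i)] {i : ℤ}
    (h : ∀ f : X i →ₗ[B] X i ⧸ LinearMap.range (d (i + 1) i), f ∘ₗ d (i + 1) i = 0 →
      ∃ h : X (i - 1) →ₗ[B] X i ⧸ LinearMap.range (d (i + 1) i), h ∘ₗ d i (i - 1) = f) :
    HasContraction d i := by
  set q := (LinearMap.range (d (i + 1) i)).mkQ with hq
  obtain ⟨k, hk⟩ := h q (LinearMap.range_mkQ_comp _)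
  obtain ⟨s', hs'⟩ := Module.projective_lifting_property q k (Submodule.mkQ_surjective _)
  obtain ⟨s, -, hs⟩ := exists_lift_of_projective (d (i + 1) i) ⊤
    (LinearMap.id - s' ∘ₗ d i (i - 1)) fun x => by
      have : q ((LinearMap.id - s' ∘ₗ d i (i - 1) : X i →ₗ[B] X i) x) = 0 := by
        have h1 := LinearMap.congr_fun hk x
        have h2 := LinearMap.congr_fun hs' (d i (i - 1) x)
        simp only [LinearMap.comp_apply] at h1 h2
        simp [h1, h2]
      rw [hq, Submodule.mkQ_apply, Submodule.Quotient.mk_eq_zero] at this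
      obtain ⟨y, hy⟩ := this
      exact ⟨y, trivial, hy⟩
  refine ⟨s, s', ?_⟩
  rw [hs]
  abel

end ExactContraction

section ApproxContraction

variable {R : Type u} {G : Type v} [Ring R] [Group G]
variable {X : ℤ → Type w} [∀ i, AddCommGroup (X i)] [∀ i, Module (MonoidAlgebra R G) (X i)]
variable {d : ∀ i j, X i →ₗ[MonoidAlgebra R G] X j}

theorem HasContraction.hasApproxContraction {i : ℤ} (h : HasContraction d i)
    [Module.Finite (MonoidAlgebra R G) (X i)] : HasApproxContraction d ∅ i := by
  obtain ⟨s, s', hs⟩ := h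
  obtain ⟨n, x, hx⟩ := Module.Finite.exists_fin (R := MonoidAlgebra R G) (M := X i)
  exact ⟨s, s', n, x, fun _ _ => 0, hx, by simp [hs], by simp⟩

theorem HasApproxContraction.of_eq {T : Finset G} {i j : ℤ} (h : HasApproxContraction d T j)
    (hi : i = j - 1) : ∃ (s : X j →ₗ[MonoidAlgebra R G] X (j + 1))
      (s' : X i →ₗ[MonoidAlgebra R G] X j),
      IsSupportedIn T (LinearMap.id - d (j + 1) j ∘ₗ s - s' ∘ₗ d j i) := by
  subst hi
  exact h

variable [∀ i, Module.Projective (MonoidAlgebra R G) (X i)]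

theorem exists_hasApproxContraction (hd : ∀ i j k, d j k ∘ₗ d i j = 0) {m n : ℤ}
    (hfin : ∀ i, m < i → Module.Finite (MonoidAlgebra R G) (X i))
    (htop : ∀ i, n < i → HasContraction d i) {χ : Character G}
    (hv : ∀ i, m < i → ∀ f : X i →ₗ[MonoidAlgebra R G] novikov R χ, f ∘ₗ d (i + 1) i = 0 →
      ∃ h : X (i - 1) →ₗ[MonoidAlgebra R G] novikov R χ, h ∘ₗ d i (i - 1) = f)
    (i : ℤ) (hi : m < i) :
    ∃ T : Finset G, (∀ g ∈ T, 0 < (χ g).toAdd) ∧ HasApproxContraction d T i := by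
  by_cases hin : n < i
  · have := hfin i hi
    exact ⟨∅, by simp, (htop i hin).hasApproxContraction⟩
  · rw [not_lt] at hin
    -- The descending induction starts at n + 1, where the contraction is exact and the support may
    -- be empty.
    have key : ∀ j : ℤ, j ≤ n + 1 → m < j →
        ∃ T : Finset G, (∀ g ∈ T, 0 < (χ g).toAdd) ∧ HasApproxContraction d T j := by
      intro j hj
      induction j, hj using Int.leInductionDown with
      | base =>
        intro h
        have := hfin (n + 1) h
        exact ⟨∅, by simp, (htop (n + 1) (by omega)).hasApproxContraction⟩
      | pred j hj ih =>
        intro h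
        obtain ⟨T, hT, hc⟩ := ih (by omega)
        obtain ⟨s, s', hs⟩ := hc.of_eq rfl
        have := hfin (j - 1) h
        exact HasApproxContraction.of_add_one hd (by omega) rfl hT hs (hv (j - 1) h)
    exact key i (by omega) hi

end ApproxContraction

/-! ### Equivariant functions with bounded support -/

section Cone

variable {R : Type u} {G : Type v} [Ring R] [Group G]
variable {A : Type w'} [AddCommGroup A] [Module R A] {N : Subgroup G}

/-- The functions `F : G → A` with `F (h * x) = x⁻¹ • F h` for `x ∈ N`; this is the module
coinduced from `A`. -/
def equivariant (ρ : N →* Module.End R A) :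
    Submodule (MonoidAlgebra R G) (TranslationModule R G A) where
  carrier := {F | ∀ (x : N) (h : G), F (h * x) = ρ x⁻¹ (F h)}
  zero_mem' x h := by simp
  add_mem' hF hF' x h := by simp [hF x h, hF' x h]
  smul_mem' c F hF x h := by
    induction c using MonoidAlgebra.induction_linear with
    | zero => simp
    | add a b ha hb => simp only [add_smul, TranslationModule.add_apply, map_add, ha, hb]
    | single g r => simp [← mul_assoc, hF x (g⁻¹ * h)]

/-- The equivariant functions with support bounded below with respect to all characters in `J`. -/
def coneModule (ρ : N →* Module.End R A) (J : Set (Character G)) :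
    Submodule (MonoidAlgebra R G) (TranslationModule R G A) :=
  equivariant ρ ⊓ ⨅ χ ∈ J, bounded R A χ

variable {ρ : N →* Module.End R A}

theorem mem_coneModule {J : Set (Character G)} {F : TranslationModule R G A} :
    F ∈ coneModule ρ J ↔ F ∈ equivariant ρ ∧ ∀ χ ∈ J, ∃ t, Above χ t F := by
  simp [coneModule, Submodule.mem_iInf, bounded]

theorem coneModule_empty : coneModule ρ ∅ = equivariant ρ := by simp [coneModule]

theorem coneModule_insert_one (J : Set (Character G)) :
    coneModule ρ (insert 1 J) = coneModule ρ J := by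
  ext F
  simp only [mem_coneModule, Set.forall_mem_insert]
  refine ⟨fun h => ⟨h.1, h.2.2⟩, fun h => ⟨h.1, ⟨0, fun x _ => ?_⟩, h.2⟩⟩
  simp

/-- Additively c is the mean of a and b, so lower bounds along a and b average to one along c. -/
theorem coneModule_inf {a b c : Character G} (hc : a * b = c ^ 2) (J : Set (Character G)) :
    coneModule ρ (insert a (insert c J)) ⊓ coneModule ρ (insert b (insert c J)) =
      coneModule ρ (insert a (insert b J)) := by
  ext F
  simp only [Submodule.mem_inf, mem_coneModule, Set.forall_mem_insert]
  refine ⟨fun h => ⟨h.1.1, h.1.2.1, h.2.2.1, h.1.2.2.2⟩, fun ⟨h, ⟨s, hs⟩, ⟨t, ht⟩, hJ⟩ => ?_⟩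
  have : Above c ((s + t) / 2) F := by
    intro g hg
    have h1 := congrArg Multiplicative.toAdd (DFunLike.congr_fun hc g)
    simp only [MonoidHom.mul_apply, MonoidHom.pow_apply, toAdd_mul, toAdd_pow, nsmul_eq_mul] at h1
    have h2 := hs g hg
    have h3 := ht g hg
    push_cast at h1
    linarith
  exact ⟨⟨h, ⟨s, hs⟩, ⟨_, this⟩, hJ⟩, ⟨h, ⟨t, ht⟩, ⟨_, this⟩, hJ⟩⟩

/-- F is cut along the wall a = b. Where b ≤ a one has c ≤ a, so the lower bound along c passes to
a, and symmetrically for b. As a and b are trivial on N, the cut respects cosets of N and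
equivariance survives. -/
theorem coneModule_sup {a b c : Character G} (hc : a * b = c ^ 2) (ha : ∀ x ∈ N, a x = 1)
    (hb : ∀ x ∈ N, b x = 1) (J : Set (Character G)) :
    coneModule ρ (insert a (insert c J)) ⊔ coneModule ρ (insert b (insert c J)) =
      coneModule ρ (insert c J) := by
  classical
  refine le_antisymm (sup_le ?_ ?_) fun F hF => ?_
  · intro F
    simp only [mem_coneModule, Set.forall_mem_insert]
    exact fun h => ⟨h.1, h.2.2⟩
  · intro F
    simp only [mem_coneModule, Set.forall_mem_insert]
    exact fun h => ⟨h.1, h.2.2⟩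
  · simp only [mem_coneModule, Set.forall_mem_insert] at hF
    obtain ⟨hN, ⟨t, ht⟩, hJ⟩ := hF
    have key : ∀ g, (a g).toAdd + (b g).toAdd = 2 * (c g).toAdd := fun g => by
      have h1 := congrArg Multiplicative.toAdd (DFunLike.congr_fun hc g)
      simpa using h1
    let F₁ : TranslationModule R G A := fun g => if (b g).toAdd ≤ (a g).toAdd then F g else 0
    let F₂ : TranslationModule R G A := fun g => if (b g).toAdd ≤ (a g).toAdd then 0 else F g
    have hF₁ : ∀ g, F₁ g ≠ 0 → (b g).toAdd ≤ (a g).toAdd ∧ F g ≠ 0 := by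
      intro g hg
      by_cases h : (b g).toAdd ≤ (a g).toAdd
      · exact ⟨h, fun h0 => hg ((if_pos h).trans h0)⟩
      · exact (hg (if_neg h)).elim
    have hF₂ : ∀ g, F₂ g ≠ 0 → (a g).toAdd ≤ (b g).toAdd ∧ F g ≠ 0 := by
      intro g hg
      by_cases h : (b g).toAdd ≤ (a g).toAdd
      · exact (hg (if_pos h)).elim
      · exact ⟨(not_le.1 h).le, fun h0 => hg ((if_neg h).trans h0)⟩
    refine Submodule.mem_sup.2 ⟨F₁, ?_, F₂, ?_, ?_⟩
    · simp only [mem_coneModule, Set.forall_mem_insert]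
      refine ⟨fun x h => ?_, ⟨t, fun g hg => ?_⟩, ⟨t, fun g hg => ht g (hF₁ g hg).2⟩,
        fun χ hχ => (hJ χ hχ).imp fun s hs g hg => hs g (hF₁ g hg).2⟩
      · simp only [F₁, map_mul, ha x x.2, hb x x.2, mul_one, hN x h]
        split_ifs <;> simp
      · have h1 := ht g (hF₁ g hg).2
        linarith [key g, (hF₁ g hg).1]
    · simp only [mem_coneModule, Set.forall_mem_insert]
      refine ⟨fun x h => ?_, ⟨t, fun g hg => ?_⟩, ⟨t, fun g hg => ht g (hF₂ g hg).2⟩,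
        fun χ hχ => (hJ χ hχ).imp fun s hs g hg => hs g (hF₂ g hg).2⟩
      · simp only [F₂, map_mul, ha x x.2, hb x x.2, mul_one, hN x h]
        split_ifs <;> simp
      · have h1 := ht g (hF₂ g hg).2
        linarith [key g, (hF₂ g hg).1]
    · ext g
      rw [TranslationModule.add_apply]
      simp only [F₁, F₂]
      split_ifs <;> simp

variable {X : ℤ → Type w} [∀ i, AddCommGroup (X i)] [∀ i, Module (MonoidAlgebra R G) (X i)]
variable {d : ∀ i j, X i →ₗ[MonoidAlgebra R G] X j} (hd : ∀ i j k, d j k ∘ₗ d i j = 0)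

theorem IsNeumannSum.mem_equivariant {P : Type w} [AddCommGroup P] [Module (MonoidAlgebra R G) P]
    {F g : P →ₗ[MonoidAlgebra R G] TranslationModule R G A} {ε : P →ₗ[MonoidAlgebra R G] P}
    (hg : IsNeumannSum F ε g) (hF : ∀ p, F p ∈ equivariant ρ) (p : P) : g p ∈ equivariant ρ := by
  intro x h
  obtain ⟨K₁, h₁⟩ := hg p h
  obtain ⟨K₂, h₂⟩ := hg p (h * x)
  rw [(h₁ (max K₁ K₂) (by omega)).2, (h₂ (max K₁ K₂) (by omega)).2, map_sum]
  exact Finset.sum_congr rfl fun k _ => hF _ x h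

include hd

/-- One character of J makes the Neumann series pointwise finite, which is why J must be nonempty.
The bound along every other character of J follows from the same growth of heights. -/
theorem HasApproxContraction.cohomologyVanishes {T : Finset G} {i : ℤ}
    (h : HasApproxContraction d T i) {J : Set (Character G)} (hJ : J.Nonempty)
    (hT : ∀ χ ∈ J, ∀ g ∈ T, 0 < (χ g).toAdd) : CohomologyVanishes d (coneModule ρ J) i := by
  intro F hF hF0
  obtain ⟨s, s', hs⟩ := h
  obtain ⟨χ, hχ⟩ := hJ
  have hb : ∀ χ ∈ J, ∀ p, F p ∈ bounded R A χ := fun χ hχ p => (mem_coneModule.1 (hF p)).2 χ hχ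
  obtain ⟨g, hg⟩ := hs.exists_isNeumannSum (hT χ hχ) (hb χ hχ)
  exact ⟨g ∘ₗ s', fun x => mem_coneModule.2
    ⟨hg.mem_equivariant (fun p => (mem_coneModule.1 (hF p)).1) _,
      fun χ hχ => hg.mem_bounded hs (hT χ hχ) (hb χ hχ) _⟩, hg.eq_comp hd hF0⟩

end Cone

/-! ### Subdivision of simplices -/

section Subdivision

variable {E : Type*} [NormedAddCommGroup E] [InnerProductSpace ℝ E]

theorem dist_midpoint_sq (a b x : E) :
    dist (midpoint ℝ a b) x ^ 2 = (dist a x ^ 2 + dist b x ^ 2) / 2 - dist a b ^ 2 / 4 := by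
  have h1 : midpoint ℝ a b - x = (1 / 2 : ℝ) • ((a - x) + (b - x)) := by
    rw [midpoint_eq_smul_add]
    simp only [invOf_eq_inv]
    module
  have h2 := parallelogram_law_with_norm ℝ (a - x) (b - x)
  have h3 : (a - x) - (b - x) = a - b := by abel
  rw [h3] at h2
  rw [dist_eq_norm, dist_eq_norm, dist_eq_norm, dist_eq_norm, h1, norm_smul, mul_pow]
  norm_num
  linarith

variable [DecidableEq E] {V : ℤ → Finset E → Prop} {m : ℤ}

/-- Induction on the number of pairs in J further apart than 9/10 * L. Bisecting such a pair
destroys it and creates no new one. Exchanging a or b for the midpoint does not enlarge J, while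
exchanging both for it lowers the cardinality by one, which pays for the degree i - 1 in
Mayer–Vietoris. -/
theorem vanishing_of_dist_le {K : Set E} (hK : Convex ℝ K)
    (hV : ∀ (i : ℤ) (a b : E) (J : Finset E), V i (insert a (insert (midpoint ℝ a b) J)) →
      V i (insert b (insert (midpoint ℝ a b) J)) → V (i - 1) (insert (midpoint ℝ a b) J) →
      V i (insert a (insert b J))) {L : ℝ}
    (h : ∀ J : Finset E, J.Nonempty → ↑J ⊆ K → (∀ x ∈ J, ∀ y ∈ J, dist x y ≤ 9 / 10 * L) →
      ∀ i : ℤ, m + J.card ≤ i → V i J) (J : Finset E) (hJ : J.Nonempty) (hJK : ↑J ⊆ K)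
    (hJL : ∀ x ∈ J, ∀ y ∈ J, dist x y ≤ L) (i : ℤ) (hi : m + J.card ≤ i) : V i J := by
  induction hc : ((J ×ˢ J).filter fun p => 9 / 10 * L < dist p.1 p.2).card
    using Nat.strong_induction_on generalizing J i with
  | _ c ih =>
  subst hc
  by_cases hs : ∀ x ∈ J, ∀ y ∈ J, dist x y ≤ 9 / 10 * L
  · exact h J hJ hJK hs i hi
  push Not at hs
  obtain ⟨a, ha, b, hb, hab⟩ := hs
  have hL : 0 ≤ L := dist_nonneg.trans (hJL a ha b hb)
  have hne : a ≠ b := by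
    rintro rfl
    rw [dist_self] at hab
    linarith
  set q := midpoint ℝ a b with hq
  set J' := (J.erase a).erase b with hJ'
  have hJ'J : ∀ x ∈ J', x ∈ J ∧ x ≠ a ∧ x ≠ b := fun x hx => by
    simp only [hJ', Finset.mem_erase] at hx
    exact ⟨hx.2.2, hx.2.1, hx.1⟩
  have hJeq : J = insert a (insert b J') := by
    rw [hJ', Finset.insert_erase (by simp [hb, hne.symm]), Finset.insert_erase ha]
  have hcard : J'.card + 2 = J.card := by
    rw [hJeq, Finset.card_insert_of_notMem, Finset.card_insert_of_notMem]
    · simp [hJ']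
    · simp [hJ', hne]
  have hqK : q ∈ K := hK.midpoint_mem (hJK ha) (hJK hb)
  have hqd : ∀ x ∈ J, dist q x ≤ 9 / 10 * L := fun x hx => by
    have h1 := dist_midpoint_sq a b x
    rw [← hq] at h1
    have h2 := hJL a ha x hx
    have h3 := hJL b hb x hx
    -- The estimate holds because 1 - (9/10)^2 / 4 ≤ (9/10)^2.
    refine abs_le_of_sq_le_sq' ?_ (by positivity) |>.2
    have h4 : dist a x ^ 2 ≤ L ^ 2 := by gcongr
    have h5 : dist b x ^ 2 ≤ L ^ 2 := by gcongr
    have h6 : (9 / 10 * L) ^ 2 ≤ dist a b ^ 2 := by gcongr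
    nlinarith
  have hqd' : ∀ x ∈ J, dist q x ≤ L := fun x hx => (hqd x hx).trans (by linarith)
  have mem_cases : ∀ (c : E), c ∈ J → ∀ x ∈ insert c (insert q J'), x = q ∨ x ∈ J := by
    intro c hc x hx
    simp only [Finset.mem_insert] at hx
    rcases hx with rfl | rfl | hx
    · exact Or.inr hc
    · exact Or.inl rfl
    · exact Or.inr (hJ'J x hx).1
  have dist_le : ∀ (J₁ : Finset E), (∀ x ∈ J₁, x = q ∨ x ∈ J) → ∀ x ∈ J₁, ∀ y ∈ J₁,
      dist x y ≤ L := by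
    intro J₁ hJ₁ x hx y hy
    rcases hJ₁ x hx with rfl | hx <;> rcases hJ₁ y hy with rfl | hy
    · simpa using hL
    · exact hqd' y hy
    · rw [dist_comm]; exact hqd' x hx
    · exact hJL x hx y hy
  have count : ∀ (J₁ : Finset E), (∀ x ∈ J₁, x = q ∨ x ∈ J) → (a ∉ J₁ ∨ b ∉ J₁) →
      ((J₁ ×ˢ J₁).filter fun p => 9 / 10 * L < dist p.1 p.2).card <
        ((J ×ˢ J).filter fun p => 9 / 10 * L < dist p.1 p.2).card := by
    intro J₁ hJ₁ hab'
    refine Finset.card_lt_card ⟨fun p hp => ?_, fun hsub => ?_⟩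
    · simp only [Finset.mem_filter, Finset.mem_product] at hp ⊢
      obtain ⟨⟨h1, h2⟩, h3⟩ := hp
      refine ⟨⟨?_, ?_⟩, h3⟩
      · rcases hJ₁ _ h1 with h | h
        · rcases hJ₁ _ h2 with h' | h'
          · rw [h, h', dist_self] at h3
            linarith
          · rw [h] at h3
            linarith [hqd _ h']
        · exact h
      · rcases hJ₁ _ h2 with h | h
        · rcases hJ₁ _ h1 with h' | h'
          · rw [h, h', dist_self] at h3
            linarith
          · rw [h, dist_comm] at h3
            linarith [hqd _ h']
        · exact h
    · have : (a, b) ∈ (J ×ˢ J).filter fun p => 9 / 10 * L < dist p.1 p.2 := by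
        simp [ha, hb, hab]
      have := hsub this
      simp only [Finset.mem_filter, Finset.mem_product] at this
      rcases hab' with h | h
      · exact h this.1.1
      · exact h this.1.2
  have hqb : q ≠ b := by
    rintro h
    have := hqd a ha
    rw [h, dist_comm] at this
    linarith
  have hqa : q ≠ a := by
    rintro h
    have := hqd b hb
    rw [h] at this
    linarith
  have step : ∀ (J₁ : Finset E), J₁.Nonempty → (∀ x ∈ J₁, x = q ∨ x ∈ J) → (a ∉ J₁ ∨ b ∉ J₁) →
      ∀ i : ℤ, m + J₁.card ≤ i → V i J₁ := by
    intro J₁ hne₁ hJ₁ hab' i hi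
    refine ih _ (count J₁ hJ₁ hab') J₁ hne₁ ?_ (dist_le J₁ hJ₁) i hi rfl
    intro x hx
    rcases hJ₁ x hx with rfl | hx
    · exact hqK
    · exact hJK hx
  rw [hJeq]
  refine hV i a b J' ?_ ?_ ?_
  · refine step _ (by simp) (mem_cases a ha) (Or.inr ?_) i ?_
    · simp [hne.symm, hqb.symm, hJ']
    · have := Finset.card_insert_le a (insert q J')
      have := Finset.card_insert_le q J'
      omega
  · refine step _ (by simp) (mem_cases b hb) (Or.inl ?_) i ?_
    · simp [hne, hqa.symm, hJ']
    · have := Finset.card_insert_le b (insert q J')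
      have := Finset.card_insert_le q J'
      omega
  · rw [← hq]
    refine step _ (by simp) (fun x hx => mem_cases a ha x (by simp at hx ⊢; tauto)) (Or.inr ?_)
      (i - 1) ?_
    · simp [hqb.symm, hJ']
    · have := Finset.card_insert_le q J'
      omega

/-- Compactness turns local vanishing into vanishing below a uniform diameter δ, a Lebesgue number.
Each use of `vanishing_of_dist_le` then enlarges the admissible diameter by the factor 10/9. -/
theorem vanishing_of_convex {K : Set E} (hK : Convex ℝ K) (hKc : IsCompact K)
    (hV : ∀ (i : ℤ) (a b : E) (J : Finset E), V i (insert a (insert (midpoint ℝ a b) J)) →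
      V i (insert b (insert (midpoint ℝ a b) J)) → V (i - 1) (insert (midpoint ℝ a b) J) →
      V i (insert a (insert b J)))
    (hloc : ∀ v ∈ K, ∃ U ∈ nhds v, ∀ J : Finset E, J.Nonempty → ↑J ⊆ U → ∀ i, m < i → V i J)
    (J : Finset E) (hJ : J.Nonempty) (hJK : ↑J ⊆ K) (i : ℤ) (hi : m + J.card ≤ i) : V i J := by
  obtain ⟨δ, hδ, h⟩ : ∃ δ > 0, ∀ J : Finset E, J.Nonempty → ↑J ⊆ K →
      (∀ x ∈ J, ∀ y ∈ J, dist x y ≤ δ) → ∀ i : ℤ, m < i → V i J := by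
    choose! U hU hUV using hloc
    obtain ⟨δ, hδ, h⟩ := lebesgue_number_lemma_of_metric (c := fun v : K => interior (U v)) hKc
      (fun _ => isOpen_interior)
      (fun v hv => Set.mem_iUnion.2 ⟨⟨v, hv⟩, mem_interior_iff_mem_nhds.2 (hU v hv)⟩)
    refine ⟨δ / 2, by positivity, fun J hJ hJK hJd i hi => ?_⟩
    obtain ⟨x, hx⟩ := hJ
    obtain ⟨v, hv⟩ := h x (hJK hx)
    refine hUV v v.2 J ⟨x, hx⟩ (fun y hy => interior_subset (hv ?_)) i hi
    rw [Metric.mem_ball]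
    linarith [hJd y hy x hx]
  have key : ∀ k : ℕ, ∀ J : Finset E, J.Nonempty → ↑J ⊆ K →
      (∀ x ∈ J, ∀ y ∈ J, dist x y ≤ δ * (10 / 9) ^ k) → ∀ i : ℤ, m + J.card ≤ i → V i J := by
    intro k
    induction k with
    | zero =>
      intro J hJ hJK hJd i hi
      have := hJ.card_pos
      exact h J hJ hJK (by simpa using hJd) i (by omega)
    | succ k ih =>
      refine vanishing_of_dist_le hK hV fun J hJ hJK hJd => ih J hJ hJK fun x hx y hy => ?_
      refine (hJd x hx y hy).trans (le_of_eq ?_)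
      ring
  obtain ⟨C, hC⟩ := Metric.isBounded_iff.1 J.finite_toSet.isBounded
  obtain ⟨k, hk⟩ := pow_unbounded_of_one_lt (C / δ) (by norm_num : (1 : ℝ) < 10 / 9)
  refine key k J hJ hJK (fun x hx y hy => (hC hx hy).trans ?_) i hi
  rw [div_lt_iff₀ hδ] at hk
  linarith

end Subdivision

/-! ### Removing antipodal pairs of directions -/

section Fan

variable {r : ℕ}

local notation "𝔼" => EuclideanSpace ℝ (Fin r)

/-- The vectors `± e_l` of the standard basis, for `l ∈ L`. -/
def signedBasis (L : Finset (Fin r)) : Finset 𝔼 := by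
  classical
  exact L.image (fun l => EuclideanSpace.single l (1 : ℝ)) ∪
    L.image fun l => -EuclideanSpace.single l (1 : ℝ)

theorem signedBasis_empty : signedBasis (∅ : Finset (Fin r)) = ∅ := by simp [signedBasis]

variable [DecidableEq (EuclideanSpace ℝ (Fin r))]

theorem signedBasis_insert (l : Fin r) (L : Finset (Fin r)) : signedBasis (insert l L) =
    insert (EuclideanSpace.single l 1) (insert (-EuclideanSpace.single l 1) (signedBasis L)) := by
  ext x
  simp only [signedBasis, Finset.mem_union, Finset.mem_image, Finset.mem_insert]
  constructor
  · rintro (⟨a, rfl | ha, rfl⟩ | ⟨a, rfl | ha, rfl⟩)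
    · exact Or.inl rfl
    · exact Or.inr (Or.inr (Or.inl ⟨a, ha, rfl⟩))
    · exact Or.inr (Or.inl rfl)
    · exact Or.inr (Or.inr (Or.inr ⟨a, ha, rfl⟩))
  · rintro (rfl | rfl | ⟨a, ha, rfl⟩ | ⟨a, ha, rfl⟩)
    · exact Or.inl ⟨l, Or.inl rfl, rfl⟩
    · exact Or.inr ⟨l, Or.inl rfl, rfl⟩
    · exact Or.inl ⟨a, Or.inr ha, rfl⟩
    · exact Or.inr ⟨a, Or.inr ha, rfl⟩

variable {V : ℤ → Finset (EuclideanSpace ℝ (Fin r)) → Prop} {m : ℤ}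

/-- Bisecting the pair ± e_l at 0 leaves J with e_l or -e_l added, where J has grown and L has
shrunk by one, and J alone, where the total has dropped by one as the degree i - 1 demands. For L =
∅, J lies in a compact convex set that avoids the origin. -/
theorem vanishing_of_pointed
    (hV : ∀ (i : ℤ) (a b : 𝔼) (J : Finset 𝔼), V i (insert a (insert (midpoint ℝ a b) J)) →
      V i (insert b (insert (midpoint ℝ a b) J)) → V (i - 1) (insert (midpoint ℝ a b) J) →
      V i (insert a (insert b J)))
    (hzero : ∀ (i : ℤ) (J : Finset 𝔼), V i (insert 0 J) ↔ V i J)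
    (hloc : ∀ v : 𝔼, v ≠ 0 →
      ∃ U ∈ nhds v, ∀ J : Finset 𝔼, J.Nonempty → ↑J ⊆ U → ∀ i, m < i → V i J)
    (L : Finset (Fin r)) (J : Finset 𝔼) (hJ : J.Nonempty)
    (hJw : ∃ w : 𝔼, ∀ x ∈ J, 1 ≤ inner ℝ w x) (hJL : ∀ x ∈ J, ∀ l ∈ L, x l = 0) (i : ℤ)
    (hi : m + J.card + L.card ≤ i) : V i (J ∪ signedBasis L) := by
  induction L using Finset.induction_on generalizing J i with
  | empty =>
    obtain ⟨w, hw⟩ := hJw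
    obtain ⟨C, hC⟩ := J.finite_toSet.isBounded.subset_closedBall 0
    rw [signedBasis_empty, Finset.union_empty]
    have hclosed : IsClosed {x : 𝔼 | 1 ≤ inner ℝ w x} :=
      isClosed_le continuous_const (by fun_prop)
    refine vanishing_of_convex (K := Metric.closedBall 0 C ∩ {x : 𝔼 | 1 ≤ inner ℝ w x})
      ((convex_closedBall 0 C).inter (convex_halfSpace_ge (innerₗ 𝔼 w).isLinear 1))
      ((isCompact_closedBall 0 C).inter_right hclosed) hV (fun v hv => hloc v ?_) J hJ
      (fun x hx => ⟨hC hx, hw x hx⟩) i (by simpa using hi)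
    rintro rfl
    have := hv.2
    simp at this
    linarith
  | insert l L hl ih =>
    rw [Finset.card_insert_of_notMem hl] at hi
    obtain ⟨w, hw⟩ := hJw
    have hsingle : ∀ c : ℝ, c * c = 1 →
        V i (insert (c • EuclideanSpace.single l (1 : ℝ)) (insert 0 (J ∪ signedBasis L))) := by
      intro c hc
      rw [Finset.insert_comm, hzero, ← Finset.insert_union]
      -- The functional w is changed only in coordinate l, where all of J vanishes. Its new value c
      -- there pairs with the added vector to c * c = 1.
      refine ih _ (by simp) ⟨w + (c - w l) • EuclideanSpace.single l (1 : ℝ), fun x hx => ?_⟩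
        (fun x hx l' hl' => ?_) i ?_
      · rcases Finset.mem_insert.1 hx with rfl | hx
        · simp [inner_add_left, inner_smul_left, inner_smul_right,
            EuclideanSpace.inner_single_right]
          nlinarith
        · have h1 := hJL x hx l (by simp)
          simpa [inner_add_left, inner_smul_left, EuclideanSpace.inner_single_left, h1]
            using hw x hx
      · rcases Finset.mem_insert.1 hx with rfl | hx
        · have : l' ≠ l := by rintro rfl; exact hl hl'
          simp [this]
        · exact hJL x hx l' (by simp [hl'])
      · have := Finset.card_insert_le (c • EuclideanSpace.single l (1 : ℝ)) J
        push_cast at hi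
        omega
    have hmid : midpoint ℝ (EuclideanSpace.single l (1 : ℝ)) (-EuclideanSpace.single l (1 : ℝ)) =
        (0 : 𝔼) := by simp
    rw [signedBasis_insert, Finset.union_insert, Finset.union_insert]
    refine hV i _ _ _ ?_ ?_ ?_
    · rw [hmid]
      simpa using hsingle 1 (by norm_num)
    · rw [hmid]
      simpa using hsingle (-1) (by norm_num)
    · rw [hmid, hzero]
      exact ih J hJ ⟨w, hw⟩ (fun x hx l' hl' => hJL x hx l' (by simp [hl'])) _
        (by push_cast at hi; omega)

/-- A family of statements about finite sets of vectors that is compatible with subdivision and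
that holds locally away from the origin holds for the empty set. -/
theorem vanishing_empty
    (hV : ∀ (i : ℤ) (a b : 𝔼) (J : Finset 𝔼), V i (insert a (insert (midpoint ℝ a b) J)) →
      V i (insert b (insert (midpoint ℝ a b) J)) → V (i - 1) (insert (midpoint ℝ a b) J) →
      V i (insert a (insert b J)))
    (hV' : ∀ (i : ℤ) (a b : 𝔼) (J : Finset 𝔼), V i (insert a (insert (midpoint ℝ a b) J)) →
      V i (insert b (insert (midpoint ℝ a b) J)) → V (i + 1) (insert a (insert b J)) →
      V i (insert (midpoint ℝ a b) J))
    (hzero : ∀ (i : ℤ) (J : Finset 𝔼), V i (insert 0 J) ↔ V i J)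
    (hloc : ∀ v : 𝔼, v ≠ 0 →
      ∃ U ∈ nhds v, ∀ J : Finset 𝔼, J.Nonempty → ↑J ⊆ U → ∀ i, m < i → V i J)
    (htop : ∀ i J, m + r < i → V i J) (i : ℤ) (hi : m < i) : V i ∅ := by
  -- Descending induction on L, with k the number of missing coordinates. The full L is covered by
  -- `htop`; `hV'` at the midpoint 0 removes a pair and gains a degree.
  have key : ∀ (k : ℕ) (L : Finset (Fin r)), L.card + k = r → ∀ i : ℤ, m + L.card < i →
      V i (signedBasis L) := by
    intro k
    induction k with
    | zero => intro L hL i hi; exact htop i _ (by omega)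
    | succ k ih =>
      intro L hL i hi
      obtain ⟨l, hl⟩ : ∃ l, l ∉ L := by
        by_contra hcon
        push Not at hcon
        rw [Finset.eq_univ_iff_forall.2 hcon, Finset.card_univ, Fintype.card_fin] at hL
        omega
      have hsingle : ∀ c : ℝ, c * c = 1 →
          V i (insert (c • EuclideanSpace.single l (1 : ℝ)) (insert 0 (signedBasis L))) := by
        intro c hc
        rw [Finset.insert_comm, hzero, Finset.insert_eq]
        refine vanishing_of_pointed hV hzero hloc L _ (by simp)
          ⟨c • EuclideanSpace.single l (1 : ℝ), ?_⟩ ?_ i (by simp; omega)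
        · simp [inner_smul_left, inner_smul_right, hc]
        · intro x hx l' hl'
          have : l' ≠ l := by rintro rfl; exact hl hl'
          rw [Finset.mem_singleton.1 hx]
          simp [this]
      have hmid : midpoint ℝ (EuclideanSpace.single l (1 : ℝ)) (-EuclideanSpace.single l (1 : ℝ)) =
          (0 : 𝔼) := by simp
      have := hV' i (EuclideanSpace.single l (1 : ℝ)) (-EuclideanSpace.single l (1 : ℝ))
        (signedBasis L)
      rw [hmid, hzero] at this
      refine this (by simpa using hsingle 1 (by norm_num))
        (by simpa using hsingle (-1) (by norm_num))
        ?_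
      rw [← signedBasis_insert]
      have hcard := Finset.card_insert_of_notMem hl
      exact ih _ (by omega) _ (by omega)
  simpa [signedBasis_empty] using key r ∅ (by simp) i (by simpa using hi)

end Fan

/-! ### Vanishing of the cohomology with coinduced coefficients -/

section LatticeCharacter

variable {G : Type v} [Group G] {r : ℕ}

/-- The character `g ↦ ∑ v_l θ(g)_l` determined by a homomorphism `θ : G → ℤ^r` and a vector
`v`. -/
def latticeCharacter (θ : G →* Multiplicative (Fin r → ℤ)) (v : EuclideanSpace ℝ (Fin r)) :
    Character G where
  toFun g := Multiplicative.ofAdd (∑ l, v l * ((θ g).toAdd l : ℝ))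
  map_one' := by simp
  map_mul' g h := by
    rw [← ofAdd_add, ← Finset.sum_add_distrib]
    simp [mul_add]

theorem toAdd_latticeCharacter (θ : G →* Multiplicative (Fin r → ℤ))
    (v : EuclideanSpace ℝ (Fin r)) (g : G) :
    (latticeCharacter θ v g).toAdd = ∑ l, v l * ((θ g).toAdd l : ℝ) := rfl

theorem latticeCharacter_zero (θ : G →* Multiplicative (Fin r → ℤ)) :
    latticeCharacter θ 0 = 1 := by
  ext g
  simp [latticeCharacter]

theorem latticeCharacter_midpoint (θ : G →* Multiplicative (Fin r → ℤ))
    (a b : EuclideanSpace ℝ (Fin r)) :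
    latticeCharacter θ a * latticeCharacter θ b = latticeCharacter θ (midpoint ℝ a b) ^ 2 := by
  refine MonoidHom.ext fun g => Multiplicative.toAdd.injective ?_
  rw [MonoidHom.mul_apply, MonoidHom.pow_apply, toAdd_mul, toAdd_pow, toAdd_latticeCharacter,
    toAdd_latticeCharacter, toAdd_latticeCharacter, midpoint_eq_smul_add, nsmul_eq_mul,
    ← Finset.sum_add_distrib, Finset.mul_sum]
  refine Finset.sum_congr rfl fun l _ => ?_
  simp
  ring

theorem latticeCharacter_apply_eq_one {θ : G →* Multiplicative (Fin r → ℤ)}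
    (v : EuclideanSpace ℝ (Fin r)) {g : G} (hg : θ g = 1) : latticeCharacter θ v g = 1 := by
  apply Multiplicative.toAdd.injective
  simp [toAdd_latticeCharacter, hg]

theorem latticeCharacter_mem {θ : G →* Multiplicative (Fin r → ℤ)} (hθ : Function.Surjective θ)
    {N : Subgroup G} (hN : ∀ x ∈ N, θ x = 1) {v : EuclideanSpace ℝ (Fin r)} (hv : v ≠ 0) :
    latticeCharacter θ v ∈ charactersVanishingOn N := by
  refine ⟨fun h => hv ?_, fun g hg => latticeCharacter_apply_eq_one v (hN g hg)⟩
  ext l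
  obtain ⟨g, hg⟩ := hθ (Multiplicative.ofAdd (Pi.single l 1))
  have := congrArg Multiplicative.toAdd (DFunLike.congr_fun h g)
  rw [toAdd_latticeCharacter, hg, Finset.sum_eq_single l] at this
  · simpa using this
  · intro l' _ hl'
    simp [Pi.single_eq_of_ne hl']
  · simp

theorem eventually_latticeCharacter_pos (θ : G →* Multiplicative (Fin r → ℤ)) (T : Finset G)
    {v : EuclideanSpace ℝ (Fin r)} (hT : ∀ g ∈ T, 0 < (latticeCharacter θ v g).toAdd) :
    ∀ᶠ v' in nhds v, ∀ g ∈ T, 0 < (latticeCharacter θ v' g).toAdd := by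
  refine (Filter.eventually_all_finset T).2 fun g hg => ?_
  have hc : Continuous fun v' : EuclideanSpace ℝ (Fin r) => (latticeCharacter θ v' g).toAdd := by
    simp only [toAdd_latticeCharacter]
    fun_prop
  exact hc.continuousAt.eventually (lt_mem_nhds (hT g hg))

end LatticeCharacter

section Main

variable {R : Type u} {G : Type v} [Ring R] [Group G]
variable {A : Type w'} [AddCommGroup A] [Module R A] {N : Subgroup G}
variable {X : ℤ → Type w} [∀ i, AddCommGroup (X i)] [∀ i, Module (MonoidAlgebra R G) (X i)]
variable {d : ∀ i j, X i →ₗ[MonoidAlgebra R G] X j}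
variable [∀ i, Module.Projective (MonoidAlgebra R G) (X i)]

/-- This is `vanishing_empty` for the vanishing of cohomology in cone modules: the bisection
hypotheses are the two halves of Mayer–Vietoris, and the local one is the Neumann series argument.
-/
theorem cohomologyVanishes_equivariant (hd : ∀ i j k, d j k ∘ₗ d i j = 0) {r : ℕ} {m : ℤ}
    (hfin : ∀ i, m < i → Module.Finite (MonoidAlgebra R G) (X i))
    (htop : ∀ i, m + r < i → HasContraction d i)
    (θ : G →* Multiplicative (Fin r → ℤ)) (hN : ∀ x ∈ N, θ x = 1)
    (hv : ∀ v : EuclideanSpace ℝ (Fin r), v ≠ 0 → ∀ i, m < i →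
      ∀ f : X i →ₗ[MonoidAlgebra R G] novikov R (latticeCharacter θ v), f ∘ₗ d (i + 1) i = 0 →
      ∃ h : X (i - 1) →ₗ[MonoidAlgebra R G] novikov R (latticeCharacter θ v),
        h ∘ₗ d i (i - 1) = f)
    (ρ : N →* Module.End R A) (i : ℤ) (hi : m < i) :
    CohomologyVanishes d (equivariant ρ) i := by
  classical
  have hN' : ∀ v, ∀ x ∈ N, latticeCharacter θ v x = 1 := fun v x hx =>
    latticeCharacter_apply_eq_one v (hN x hx)
  have main := vanishing_empty (r := r) (m := m) (V := fun i J =>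
    CohomologyVanishes d (coneModule ρ (latticeCharacter θ '' ↑J)) i) ?_ ?_ ?_ ?_ ?_ i hi
  · simpa [coneModule_empty] using main
  · intro i a b J h₁ h₂ h₃
    simp only [Finset.coe_insert, Set.image_insert_eq] at h₁ h₂ h₃ ⊢
    have hm := latticeCharacter_midpoint θ a b
    rw [← coneModule_inf hm]
    refine h₁.inf hd h₂ ?_
    rwa [coneModule_sup hm (hN' a) (hN' b)]
  · intro i a b J h₁ h₂ h₃
    simp only [Finset.coe_insert, Set.image_insert_eq] at h₁ h₂ h₃ ⊢
    have hm := latticeCharacter_midpoint θ a b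
    rw [← coneModule_sup hm (hN' a) (hN' b)]
    refine h₁.sup hd h₂ ?_
    rwa [coneModule_inf hm]
  · intro i J
    simp only [Finset.coe_insert, Set.image_insert_eq, latticeCharacter_zero,
      coneModule_insert_one]
  · intro v hv0
    choose! T hT hTc using exists_hasApproxContraction hd hfin htop (hv v hv0)
    -- Above m + r the contractions are exact, so only the finitely many degrees in (m, m + r]
    -- restrict the neighbourhood of v.
    refine ⟨_, (Filter.eventually_all_finset (Finset.Ioc m (m + r))).2 fun i hi =>
      eventually_latticeCharacter_pos θ (T i) (hT i (Finset.mem_Ioc.1 hi).1),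
      fun J hJ hJU i hi => ?_⟩
    by_cases hir : m + r < i
    · exact (htop i hir).cohomologyVanishes _
    · refine (hTc i hi).cohomologyVanishes hd (hJ.to_set.image _) ?_
      rintro _ ⟨v', hv', rfl⟩
      exact hJU hv' i (Finset.mem_Ioc.2 ⟨hi, not_lt.1 hir⟩)
  · intro i J hi
    exact (htop i hi).cohomologyVanishes _

end Main

/-! ### Restriction to subgroups and coinduced coefficients -/

section Restriction

variable {R : Type u} {G : Type v} [Ring R] [Group G]
variable {A : Type w'} [AddCommGroup A] [Module R A] {N : Subgroup G}

/-- An additive map from an `R[G]`-module to an `R`-linear representation of `N` is linear over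
`R[N]`. -/
def IsSubgroupLinear (ρ : N →* Module.End R A) {P : Type w} [AddCommGroup P]
    [Module (MonoidAlgebra R G) P] (f : P →+ A) : Prop :=
  ∀ (x : N) (r : R) (p : P), f (MonoidAlgebra.single (x : G) r • p) = r • ρ x (f p)

variable {ρ : N →* Module.End R A}

theorem IsSubgroupLinear.exists_equivariant {P : Type w} [AddCommGroup P]
    [Module (MonoidAlgebra R G) P] {f : P →+ A} (hf : IsSubgroupLinear ρ f) :
    ∃ F : P →ₗ[MonoidAlgebra R G] TranslationModule R G A, (∀ p, F p ∈ equivariant ρ) ∧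
      ∀ p h, F p h = f (MonoidAlgebra.single h⁻¹ (1 : R) • p) := by
  refine ⟨linearMapOfSingle
    { toFun := fun p h => f (MonoidAlgebra.single h⁻¹ (1 : R) • p)
      map_zero' := funext fun h => by rw [smul_zero, map_zero]; rfl
      map_add' := fun p q => funext fun h => by rw [smul_add, map_add]; rfl }
    fun g r p => ?_, fun p x h => ?_, fun p h => rfl⟩
  · ext h
    rw [single_smul_apply]
    change f (MonoidAlgebra.single h⁻¹ (1 : R) • MonoidAlgebra.single g r • p) =
      r • f (MonoidAlgebra.single (g⁻¹ * h)⁻¹ (1 : R) • p)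
    have := hf 1 r (MonoidAlgebra.single (g⁻¹ * h)⁻¹ (1 : R) • p)
    rw [map_one, Module.End.one_apply] at this
    rw [← this, smul_smul, smul_smul, MonoidAlgebra.single_mul_single,
      MonoidAlgebra.single_mul_single]
    simp
  · change f (MonoidAlgebra.single (h * x)⁻¹ (1 : R) • p) =
      ρ x⁻¹ (f (MonoidAlgebra.single h⁻¹ (1 : R) • p))
    have := hf x⁻¹ 1 (MonoidAlgebra.single h⁻¹ (1 : R) • p)
    rw [one_smul] at this
    rw [← this, smul_smul, MonoidAlgebra.single_mul_single]
    simp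

theorem isSubgroupLinear_evalHom_comp {P : Type w} [AddCommGroup P] [Module (MonoidAlgebra R G) P]
    (F : P →ₗ[MonoidAlgebra R G] TranslationModule R G A) (hF : ∀ p, F p ∈ equivariant ρ) :
    IsSubgroupLinear ρ ((evalHom 1).comp F.toAddMonoidHom) := by
  intro x r p
  have h1 := hF p x⁻¹ 1
  simp only [one_mul, inv_inv] at h1
  change F (MonoidAlgebra.single (x : G) r • p) 1 = r • ρ x (F p 1)
  rw [map_smul, single_smul_apply, mul_one, ← h1]
  rfl

variable {X : ℤ → Type w} [∀ i, AddCommGroup (X i)] [∀ i, Module (MonoidAlgebra R G) (X i)]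
variable {d : ∀ i j, X i →ₗ[MonoidAlgebra R G] X j}

/-- Shapiro's lemma: evaluation at 1 and f ↦ (p ↦ (h ↦ f (h⁻¹ • p))) are mutually inverse and
commute with the differentials. -/
theorem cohomologyVanishes_equivariant_iff {i : ℤ} :
    CohomologyVanishes d (equivariant ρ) i ↔
      ∀ f : X i →+ A, IsSubgroupLinear ρ f → (∀ y, f (d (i + 1) i y) = 0) →
        ∃ h : X (i - 1) →+ A, IsSubgroupLinear ρ h ∧ ∀ y, h (d i (i - 1) y) = f y := by
  constructor
  · intro H f hf hf0
    obtain ⟨F, hF, hFf⟩ := hf.exists_equivariant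
    obtain ⟨h, hh, hhF⟩ := H F hF (by
      ext y g
      rw [LinearMap.comp_apply, hFf, ← map_smul, hf0]
      rfl)
    refine ⟨_, isSubgroupLinear_evalHom_comp h hh, fun y => ?_⟩
    have h1 := hFf y 1
    have h2 : h (d i (i - 1) y) = F y := LinearMap.congr_fun hhF y
    change h (d i (i - 1) y) 1 = f y
    rw [h2, h1, inv_one, ← MonoidAlgebra.one_def, one_smul]
  · intro H F hF hF0
    obtain ⟨h, hh, hhf⟩ := H _ (isSubgroupLinear_evalHom_comp F hF) fun y => by
      have : F (d (i + 1) i y) = 0 := LinearMap.congr_fun hF0 y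
      change F (d (i + 1) i y) 1 = 0
      rw [this]
      rfl
    obtain ⟨F', hF', e⟩ := hh.exists_equivariant
    refine ⟨F', hF', LinearMap.ext fun y => ?_⟩
    ext g
    rw [LinearMap.comp_apply, e, ← map_smul, hhf]
    change F (MonoidAlgebra.single g⁻¹ (1 : R) • y) 1 = F y g
    simp

/-- The representation of a group `H` on an `R[H]`-module. -/
def groupAction {H : Type v} [Group H] [Module (MonoidAlgebra R H) A]
    (hA : ∀ (r : R) (a : A), MonoidAlgebra.single (1 : H) r • a = r • a) :
    H →* Module.End R A where
  toFun x :=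
    { toFun := fun a => MonoidAlgebra.single x (1 : R) • a
      map_add' := smul_add _
      map_smul' := fun r a => by
        rw [RingHom.id_apply, ← hA r a, ← hA r (MonoidAlgebra.single x (1 : R) • a), smul_smul,
          smul_smul, MonoidAlgebra.single_mul_single, MonoidAlgebra.single_mul_single]
        simp }
  map_one' := LinearMap.ext fun a => by
    change MonoidAlgebra.single (1 : H) (1 : R) • a = a
    rw [← MonoidAlgebra.one_def, one_smul]
  map_mul' x y := LinearMap.ext fun a => by
    change MonoidAlgebra.single (x * y) (1 : R) • a =
      MonoidAlgebra.single x (1 : R) • MonoidAlgebra.single y (1 : R) • a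
    rw [smul_smul, MonoidAlgebra.single_mul_single, one_mul]

theorem groupAction_apply {H : Type v} [Group H] [Module (MonoidAlgebra R H) A]
    (hA : ∀ (r : R) (a : A), MonoidAlgebra.single (1 : H) r • a = r • a) (x : H) (a : A) :
    groupAction hA x a = MonoidAlgebra.single x (1 : R) • a := rfl

theorem smul_groupAction_apply {H : Type v} [Group H] [Module (MonoidAlgebra R H) A]
    (hA : ∀ (r : R) (a : A), MonoidAlgebra.single (1 : H) r • a = r • a) (x : H) (r : R) (a : A) :
    r • groupAction hA x a = MonoidAlgebra.single x r • a := by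
  rw [groupAction_apply, ← hA, smul_smul, MonoidAlgebra.single_mul_single, one_mul, mul_one]

end Restriction

/-! ### Extensions by free abelian groups -/

section Extension

variable {R : Type u} {G : Type v} [Ring R] [Group G]
variable {A : Type w'} [AddCommGroup A] [Module R A] (σ : G →* Module.End R A)

theorem exists_primitive (u : ℤ → A) : ∃ W : ℤ → A, ∀ k, W (k + 1) - W k = u k := by
  refine ⟨fun k => ∑ j ∈ Finset.range k.toNat, u j -
    ∑ j ∈ Finset.range (-k).toNat, u (-(j + 1 : ℕ)), fun k => ?_⟩
  rcases le_or_gt 0 k with hk | hk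
  · lift k to ℕ using hk
    have h1 : ((k : ℤ) + 1).toNat = k + 1 := by omega
    have h2 : (-((k : ℤ) + 1)).toNat = 0 := by omega
    have h3 : (-(k : ℤ)).toNat = 0 := by omega
    simp only [h1, h2, h3, Finset.sum_range_succ, Int.toNat_natCast]
    simp
  · obtain ⟨l, rfl⟩ : ∃ l : ℕ, k = -((l + 1 : ℕ) : ℤ) := ⟨(-k).toNat - 1, by omega⟩
    have h1 : (-((l + 1 : ℕ) : ℤ) + 1).toNat = 0 := by omega
    have h2 : (-(-((l + 1 : ℕ) : ℤ) + 1)).toNat = l := by omega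
    have h3 : (-((l + 1 : ℕ) : ℤ)).toNat = 0 := by omega
    have h4 : (- -((l + 1 : ℕ) : ℤ)).toNat = l + 1 := by omega
    simp only [h1, h2, h3, h4, Finset.sum_range_succ]
    simp

/-- The difference operator `F ↦ (h ↦ t • F (h * t) - F h)`. -/
def differenceOperator (t : G) :
    TranslationModule R G A →ₗ[MonoidAlgebra R G] TranslationModule R G A :=
  linearMapOfSingle
    { toFun := fun F h => σ t (F (h * t)) - F h
      map_zero' := by ext; simp
      map_add' := by
        intro F F'
        refine funext fun h => ?_
        change σ t (F (h * t) + F' (h * t)) - (F h + F' h) =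
          σ t (F (h * t)) - F h + (σ t (F' (h * t)) - F' h)
        rw [map_add]
        abel }
    fun g r F => by
      ext h
      rw [single_smul_apply]
      change σ t ((MonoidAlgebra.single g r • F) (h * t)) - (MonoidAlgebra.single g r • F) h =
        r • (σ t (F (g⁻¹ * h * t)) - F (g⁻¹ * h))
      rw [single_smul_apply, single_smul_apply, map_smul, smul_sub, mul_assoc]

theorem differenceOperator_apply (t : G) (F : TranslationModule R G A) (h : G) :
    differenceOperator σ t F h = σ t (F (h * t)) - F h := rfl

variable {σ} {H H' : Subgroup G} [H.Normal] {t : G}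

theorem apply_apply_inv (x : G) (a : A) : σ x (σ x⁻¹ a) = a := by
  rw [← Module.End.mul_apply, ← map_mul, mul_inv_cancel, map_one, Module.End.one_apply]

theorem apply_inv_apply (x : G) (a : A) : σ x⁻¹ (σ x a) = a := by
  rw [← Module.End.mul_apply, ← map_mul, inv_mul_cancel, map_one, Module.End.one_apply]

theorem differenceOperator_mem {F : TranslationModule R G A}
    (hF : F ∈ equivariant (σ.comp H.subtype)) :
    differenceOperator σ t F ∈ equivariant (σ.comp H.subtype) := by
  intro x h
  have h1 := hF ⟨t⁻¹ * x * t, by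
    simpa using ‹H.Normal›.conj_mem x x.2 t⁻¹⟩ (h * t)
  have h2 := hF x h
  simp only [MonoidHom.comp_apply, Subgroup.subtype_apply] at h1 h2 ⊢
  have e : h * x * t = h * t * (t⁻¹ * x * t) := by group
  simp only [Subgroup.coe_inv] at h1 h2 ⊢
  rw [differenceOperator_apply, differenceOperator_apply, e, h1, h2, map_sub,
    ← Module.End.mul_apply, ← Module.End.mul_apply, ← map_mul, ← map_mul]
  congr 3
  group

/-- Twisting by σ turns U into a function U' constant on the cosets h H and the equation into Q (h *
t) - Q h = U' h. This is solved by summation along each orbit of t. -/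
theorem exists_differenceOperator_eq (τ : G →* Multiplicative ℤ)
    (ht : τ t = Multiplicative.ofAdd 1) (hH : ∀ x ∈ H, τ x = 1) {U : TranslationModule R G A}
    (hU : U ∈ equivariant (σ.comp H.subtype)) :
    ∃ F ∈ equivariant (σ.comp H.subtype), differenceOperator σ t F = U := by
  choose W hW using exists_primitive (A := A)
  let U' : G → A := fun h => σ h (U h)
  have hU' : ∀ h, ∀ x ∈ H, U' (h * x) = U' h := by
    intro h x hx
    have h1 := hU ⟨x, hx⟩ h
    simp only [MonoidHom.comp_apply, Subgroup.subtype_apply, Subgroup.coe_inv] at h1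
    simp only [U', h1, map_mul, Module.End.mul_apply, apply_apply_inv]
  let c : G → ℤ := fun h => (τ h).toAdd
  -- Indexing the orbit by the absolute height `c` makes the summed sequence the same for h, h * t
  -- and h * x with x ∈ H, so the chosen primitives are compatible.
  let Q : G → A := fun h => W (fun k => U' (h * t ^ (k - c h))) (c h)
  have hct : ∀ h, c (h * t) = c h + 1 := fun h => by simp [c, ht]
  have hcx : ∀ h, ∀ x ∈ H, c (h * x) = c h := fun h x hx => by simp [c, hH x hx]
  have hQt : ∀ h, Q (h * t) - Q h = U' h := by
    intro h
    have e : (fun k => U' (h * t * t ^ (k - c (h * t)))) = fun k => U' (h * t ^ (k - c h)) := by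
      ext k
      rw [hct, mul_assoc, ← zpow_one_add]
      congr 3
      ring
    simp only [Q]
    rw [e, hct, hW]
    simp
  have hQx : ∀ h, ∀ x ∈ H, Q (h * x) = Q h := by
    intro h x hx
    simp only [Q]
    rw [hcx h x hx]
    congr 1
    ext k
    have e : h * x * t ^ (k - c h) =
        h * t ^ (k - c h) * ((t ^ (k - c h))⁻¹ * x * t ^ (k - c h)) := by group
    rw [e, hU' _ _ (by simpa using ‹H.Normal›.conj_mem x hx (t ^ (k - c h))⁻¹)]
  refine ⟨fun h => σ h⁻¹ (Q h), fun x h => ?_, ?_⟩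
  · simp only [MonoidHom.comp_apply, Subgroup.subtype_apply, Subgroup.coe_inv, hQx h x x.2,
      mul_inv_rev, map_mul, Module.End.mul_apply]
  · ext h
    change σ t (σ (h * t)⁻¹ (Q (h * t))) - σ h⁻¹ (Q h) = U h
    have h1 : Q (h * t) = U' h + Q h := by rw [← hQt h]; abel
    simp only [h1, mul_inv_rev, map_mul, Module.End.mul_apply, apply_apply_inv, map_add, U',
      apply_inv_apply]
    abel

/-- The kernel condition is equivariance under t, and every element of H' is a power of t times an
element of H. -/
theorem equivariant_eq_inf_ker (hHH' : H ≤ H') (htH : t ∈ H')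
    (hgen : ∀ x ∈ H', ∃ k : ℤ, t ^ k * x ∈ H) :
    equivariant (σ.comp H'.subtype) =
      equivariant (σ.comp H.subtype) ⊓ LinearMap.ker (differenceOperator σ t) := by
  ext F
  simp only [Submodule.mem_inf, LinearMap.mem_ker]
  constructor
  · intro hF
    refine ⟨fun x h => hF ⟨x, hHH' x.2⟩ h, ?_⟩
    ext h
    have h1 := hF ⟨t, htH⟩ h
    simp only [MonoidHom.comp_apply, Subgroup.subtype_apply, Subgroup.coe_inv] at h1
    rw [differenceOperator_apply, h1, apply_apply_inv]
    simp
  · rintro ⟨hF, hD⟩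
    have h1 : ∀ h, F (h * t) = σ t⁻¹ (F h) := by
      intro h
      have := congrFun hD h
      change σ t (F (h * t)) - F h = 0 at this
      rw [← sub_eq_zero.1 this, apply_inv_apply]
    have h2 : ∀ (k : ℤ) h, F (h * t ^ k) = σ (t ^ k)⁻¹ (F h) := by
      intro k
      induction k using Int.induction_on with
      | zero => simp
      | succ k ih =>
        intro h
        rw [zpow_add_one, ← mul_assoc, h1, ih, mul_inv_rev, map_mul, Module.End.mul_apply]
      | pred k ih =>
        intro h
        have h3 := h1 (h * t ^ (-(k : ℤ) - 1))
        rw [mul_assoc, ← zpow_add_one, sub_add_cancel, ih] at h3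
        have h4 := congrArg (σ t) h3
        rw [apply_apply_inv] at h4
        rw [← h4, ← Module.End.mul_apply, ← map_mul]
        congr 2
        group
    intro x h
    obtain ⟨k, hk⟩ := hgen x x.2
    have h3 := hF ⟨t ^ k * x, hk⟩ (h * t ^ (-k))
    have e : h * t ^ (-k) * (t ^ k * x) = h * x := by group
    simp only [MonoidHom.comp_apply, Subgroup.subtype_apply, Subgroup.coe_inv] at h3 ⊢
    rw [e, h2, ← Module.End.mul_apply, ← map_mul] at h3
    rw [h3]
    congr 2
    group

variable {X : ℤ → Type w} [∀ i, AddCommGroup (X i)] [∀ i, Module (MonoidAlgebra R G) (X i)]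
variable {d : ∀ i j, X i →ₗ[MonoidAlgebra R G] X j}
variable [∀ i, Module.Projective (MonoidAlgebra R G) (X i)]

/-- The preimage under `θ` of the subgroup of `ℤ^r` spanned by the first `j` basis vectors. -/
def flagSubgroup {r : ℕ} (θ : G →* Multiplicative (Fin r → ℤ)) (j : ℕ) : Subgroup G where
  carrier := {g | ∀ l : Fin r, j ≤ l → (θ g).toAdd l = 0}
  one_mem' l _ := by simp
  mul_mem' ha hb l hl := by simp [ha l hl, hb l hl]
  inv_mem' ha l hl := by simp [ha l hl]

theorem mem_flagSubgroup {r : ℕ} {θ : G →* Multiplicative (Fin r → ℤ)} {j : ℕ} {g : G} :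
    g ∈ flagSubgroup θ j ↔ ∀ l : Fin r, j ≤ l → (θ g).toAdd l = 0 := Iff.rfl

instance {r : ℕ} (θ : G →* Multiplicative (Fin r → ℤ)) (j : ℕ) : (flagSubgroup θ j).Normal where
  conj_mem n hn g l hl := by simp [hn l hl]

/-- Consecutive flag subgroups differ by an infinite cyclic quotient generated by a lift t of a
basis vector. The short exact sequence of the difference operator of t costs one degree per step. -/
theorem CohomologyVanishes.flagSubgroup (hd : ∀ i j k, d j k ∘ₗ d i j = 0) {r : ℕ}
    {θ : G →* Multiplicative (Fin r → ℤ)} (hθ : Function.Surjective θ) {m : ℤ}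
    (hv : ∀ i, m < i → CohomologyVanishes d (equivariant (σ.comp (flagSubgroup θ 0).subtype)) i)
    (j : ℕ) (hj : j ≤ r) (i : ℤ) (hi : m + j < i) :
    CohomologyVanishes d (equivariant (σ.comp (CoAbelian.flagSubgroup θ j).subtype)) i := by
  induction j generalizing i with
  | zero => exact hv i (by simpa using hi)
  | succ j ih =>
    obtain ⟨t, ht⟩ := hθ (Multiplicative.ofAdd (Pi.single ⟨j, hj⟩ 1))
    let τ : G →* Multiplicative ℤ :=
      (AddMonoidHom.toMultiplicative (Pi.evalAddMonoidHom (fun _ => ℤ) ⟨j, hj⟩)).comp θ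
    have hτ : ∀ g, (τ g).toAdd = (θ g).toAdd ⟨j, hj⟩ := fun _ => rfl
    rw [equivariant_eq_inf_ker (H := CoAbelian.flagSubgroup θ j) (t := t)]
    · refine CohomologyVanishes.ker hd _ (fun F hF => differenceOperator_mem hF)
        (fun U hU => exists_differenceOperator_eq τ ?_ ?_ hU)
        (ih (by omega) i (by push_cast at hi; omega))
        (ih (by omega) (i - 1) (by push_cast at hi; omega))
      · apply Multiplicative.toAdd.injective
        rw [hτ, ht]
        simp
      · intro x hx
        apply Multiplicative.toAdd.injective
        rw [hτ]
        exact hx _ le_rfl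
    · exact fun x hx l hl => hx l (by omega)
    · intro l hl
      rw [ht]
      exact Pi.single_eq_of_ne (by rintro rfl; simp at hl) _
    · intro x hx
      refine ⟨-(θ x).toAdd ⟨j, hj⟩, fun l hl => ?_⟩
      rw [map_mul, map_zpow, ht]
      rcases Nat.lt_or_ge j l with h | h
      · have : l ≠ ⟨j, hj⟩ := by rintro rfl; simp at h
        simp [hx l h, Pi.single_eq_of_ne this]
      · obtain rfl : l = ⟨j, hj⟩ := Fin.ext (le_antisymm h hl)
        simp

end Extension

/-! ### Restriction of modules and complexes to a subgroup -/

section Coinduction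

variable {R : Type u} {G : Type v} [Ring R] [Group G] {N : Subgroup G}
variable {A : Type w} [AddCommGroup A] [Module R A] {A' : Type w'} [AddCommGroup A'] [Module R A']

variable (G) in
/-- Postcomposition of functions with a linear map. -/
def postcomp (e : A →ₗ[R] A') :
    TranslationModule R G A →ₗ[MonoidAlgebra R G] TranslationModule R G A' :=
  linearMapOfSingle
    { toFun := fun F h => e (F h)
      map_zero' := funext fun _ => map_zero e
      map_add' := fun _ _ => funext fun _ => map_add e _ _ }
    fun g r F => by
      ext h
      rw [single_smul_apply]
      change e ((MonoidAlgebra.single g r • F) h) = r • e (F (g⁻¹ * h))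
      rw [single_smul_apply, map_smul]

/-- Coinduction preserves surjections. -/
theorem exists_postcomp_eq {ρ : N →* Module.End R A} {ρ' : N →* Module.End R A'}
    {e : A →ₗ[R] A'} (he : Function.Surjective e) (heq : ∀ x a, e (ρ x a) = ρ' x (e a))
    {F' : TranslationModule R G A'} (hF' : F' ∈ equivariant ρ') :
    ∃ F ∈ equivariant ρ, postcomp G e F = F' := by
  -- With h = rep h * n h and n h ∈ N, a set-theoretic lift is chosen at the coset representatives
  -- and extended by equivariance.
  choose s hs using he
  let rep : G → G := fun h => (QuotientGroup.mk (s := N) h).out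
  have hrep : ∀ h, (rep h)⁻¹ * h ∈ N := fun h =>
    QuotientGroup.eq.1 (Quotient.out_eq' (QuotientGroup.mk (s := N) h))
  have hrepx : ∀ h (x : N), rep (h * x) = rep h := fun h x =>
    congrArg Quotient.out (QuotientGroup.mk_mul_of_mem h x.2)
  let n : G → N := fun h => ⟨(rep h)⁻¹ * h, hrep h⟩
  have hn : ∀ h (x : N), n (h * x) = n h * x := by
    intro h x
    apply Subtype.ext
    change (rep (h * x))⁻¹ * (h * x) = (rep h)⁻¹ * h * x
    rw [hrepx, mul_assoc]
  refine ⟨fun h => ρ (n h)⁻¹ (s (F' (rep h))), fun x h => ?_, ?_⟩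
  · change ρ (n (h * x))⁻¹ (s (F' (rep (h * x)))) = ρ x⁻¹ (ρ (n h)⁻¹ (s (F' (rep h))))
    rw [hn, hrepx, mul_inv_rev, map_mul, Module.End.mul_apply]
  · ext h
    change e (ρ (n h)⁻¹ (s (F' (rep h)))) = F' h
    rw [heq, hs, ← hF' (n h) (rep h)]
    congr 1
    simp [n]

end Coinduction

section ModuleCat

variable {R : Type u} {G : Type v} [Ring R] [Group G]

/-- The underlying `R`-module of an `R[G]`-module. -/
abbrev scalarModule (R : Type u) (G : Type v) [Ring R] [Group G] (M : Type w) [AddCommGroup M]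
    [Module (MonoidAlgebra R G) M] : Module R M :=
  Module.compHom M (MonoidAlgebra.singleOneRingHom : R →+* MonoidAlgebra R G)

theorem single_one_smul {M : Type w} [AddCommGroup M] [Module (MonoidAlgebra R G) M] (r : R)
    (a : M) :
    letI := scalarModule R G M
    MonoidAlgebra.single (1 : G) r • a = r • a := rfl

/-- The representation of `G` on an `R[G]`-module. -/
abbrev moduleAction (R : Type u) (G : Type v) [Ring R] [Group G] (M : Type w) [AddCommGroup M]
    [Module (MonoidAlgebra R G) M] :
    letI := scalarModule R G M
    G →* Module.End R M :=
  letI := scalarModule R G M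
  groupAction single_one_smul

variable (R) in
/-- Restriction of `R[G]`-modules to a subgroup `N`. -/
abbrev resFunctor (N : Subgroup G) : ModuleCat.{max u v} (MonoidAlgebra R G) ⥤
    ModuleCat.{max u v} (MonoidAlgebra R N) :=
  ModuleCat.restrictScalars.{max u v} (MonoidAlgebra.mapDomainRingHom R N.subtype)

variable {N : Subgroup G}

theorem res_single_smul (P : ModuleCat.{max u v} (MonoidAlgebra R G)) (x : N) (r : R) (p : P) :
    (MonoidAlgebra.single x r • (show (resFunctor R N).obj P from p) : (resFunctor R N).obj P) =
      MonoidAlgebra.single (x : G) r • p := by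
  have h : MonoidAlgebra.mapDomainRingHom R N.subtype (MonoidAlgebra.single x r) =
      MonoidAlgebra.single (x : G) r := by simp
  exact congrArg (fun c => c • p) h

theorem hom_single_smul {P : ModuleCat.{max u v} (MonoidAlgebra R G)}
    {M : ModuleCat.{max u v} (MonoidAlgebra R N)} (f : (resFunctor R N).obj P ⟶ M) (x : N) (r : R)
    (p : P) : (f.hom.toAddMonoidHom : P →+ M) (MonoidAlgebra.single (x : G) r • p) =
      MonoidAlgebra.single x r • (f.hom.toAddMonoidHom : P →+ M) p := by
  have := f.hom.map_smul (MonoidAlgebra.single x r) p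
  rwa [res_single_smul] at this

theorem exists_hom_of_single_smul {P : ModuleCat.{max u v} (MonoidAlgebra R G)}
    {M : ModuleCat.{max u v} (MonoidAlgebra R N)} (f : P →+ M)
    (hf : ∀ (x : N) (r : R) (p : P), f (MonoidAlgebra.single (x : G) r • p) =
      MonoidAlgebra.single x r • f p) :
    ∃ f' : (resFunctor R N).obj P ⟶ M, ∀ p : P, f'.hom p = f p := by
  let l : (resFunctor R N).obj P →ₗ[MonoidAlgebra R N] M :=
    @linearMapOfSingle R N _ _ ((resFunctor R N).obj P) M _ _ _ _ f fun x r p =>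
      (congrArg f (res_single_smul P x r p)).trans (hf x r p)
  let l' := ModuleCat.ofHom l
  exact ⟨l', fun p => rfl⟩

theorem isSubgroupLinear_iff {P : Type w'} [AddCommGroup P] [Module (MonoidAlgebra R G) P]
    {M : Type w} [AddCommGroup M] [Module (MonoidAlgebra R N) M] {f : P →+ M} :
    letI := scalarModule R N M
    IsSubgroupLinear (moduleAction R N M) f ↔ ∀ (x : N) (r : R) (p : P),
      f (MonoidAlgebra.single (x : G) r • p) = MonoidAlgebra.single x r • f p := by
  let := scalarModule R N M
  refine forall_congr' fun x => forall_congr' fun r => forall_congr' fun p => ?_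
  rw [smul_groupAction_apply]

/-- Restriction is left adjoint to coinduction, which preserves surjections: a map is transposed,
lifted among equivariant functions and evaluated at 1. -/
instance : (resFunctor R N).PreservesProjectiveObjects where
  projective_obj {P} hP := by
    have hP' : Module.Projective (MonoidAlgebra R G) P :=
      (IsProjective.iff_projective (R := MonoidAlgebra R G) P).2 hP
    refine ⟨fun {E Y} f e he => ?_⟩
    let := scalarModule R N Y
    let := scalarModule R N E
    let e' : E →ₗ[R] Y :=
      { toFun := e.hom
        map_add' := map_add e.hom
        map_smul' := fun r a => e.hom.map_smul (MonoidAlgebra.single 1 r) a }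
    obtain ⟨F, hF, hFf⟩ := (isSubgroupLinear_iff.2 (hom_single_smul f)).exists_equivariant
    obtain ⟨F', hF', hFF'⟩ := exists_lift_of_projective (postcomp G e')
      (equivariant (moduleAction R N E)) F fun p =>
        exists_postcomp_eq (e := e') ((ModuleCat.epi_iff_surjective e).1 he)
          (fun x a => e.hom.map_smul (MonoidAlgebra.single x 1) a) (hF p)
    obtain ⟨f', hf'⟩ := exists_hom_of_single_smul _
      (isSubgroupLinear_iff.1 (isSubgroupLinear_evalHom_comp F' hF'))
    have hf1 : ∀ p : P, F p 1 = f.hom p := fun p => by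
      rw [hFf, inv_one, ← MonoidAlgebra.one_def, one_smul]
      rfl
    refine ⟨f', ?_⟩
    ext p
    change e.hom (f'.hom p) = f.hom p
    refine (congrArg e.hom (hf' p)).trans ?_
    have h1 := congrFun (LinearMap.congr_fun hFF' p) 1
    exact h1.trans (hf1 p)

end ModuleCat

/-! ### The cohomological dimension of a restricted complex -/

section Complex

theorem subsingleton_cohomology_iff {B : Type w} [Ring B] {C : ChainComplex (ModuleCat.{w'} B) ℤ}
    {M : ModuleCat.{w'} B} {i : ℤ} : Subsingleton (cohomology C M i) ↔
      ∀ f : C.X i ⟶ M, C.d (i + 1) i ≫ f = 0 → ∃ h : C.X (i - 1) ⟶ M, C.d i (i - 1) ≫ h = f := by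
  constructor
  · intro hs f hf
    have h1 : (QuotientAddGroup.mk (⟨f, hf⟩ : cocycles C M i) : cohomology C M i) = 0 :=
      Subsingleton.elim _ _
    rw [QuotientAddGroup.eq_zero_iff] at h1
    exact h1
  · intro h
    refine ⟨fun a b => ?_⟩
    have key : ∀ a : cohomology C M i, a = 0 := by
      intro a
      obtain ⟨⟨f, hf⟩, rfl⟩ := QuotientAddGroup.mk_surjective a
      rw [QuotientAddGroup.eq_zero_iff]
      exact h f hf
    rw [key a, key b]

variable {R : Type u} {G : Type v} [Ring R] [Group G]

theorem complexCd_resComplex_le (C : ChainComplex (ModuleCat.{max u v} (MonoidAlgebra R G)) ℤ)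
    (n : ℤ) {r : ℕ} {N : Subgroup G} (θ : G →* Multiplicative (Fin r → ℤ))
    (hθ : Function.Surjective θ) (hN : ∀ x ∈ N, θ x = 1)
    (hproj : ∀ i, Module.Projective (MonoidAlgebra R G) (C.X i))
    (hfin : ∀ i, Module.Finite (MonoidAlgebra R G) (C.X i))
    (hn : ∀ i, n < i → Subsingleton (C.X i))
    (hv : ∀ φ ∈ charactersVanishingOn N, ∀ i : ℤ, n - r < i →
      Subsingleton (cohomology C (novikovModule R φ) i)) :
    complexCd (resComplex R N C) ≤ (((n - r : ℤ) : WithTop ℤ) : WithBot (WithTop ℤ)) := by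
  refine sSup_le ?_
  rintro _ ⟨i, ⟨M, hM⟩, rfl⟩
  by_contra hi
  have hi' : n - r < i := by
    rw [not_le] at hi
    exact WithTop.coe_lt_coe.1 (WithBot.coe_lt_coe.1 hi)
  rw [← not_subsingleton_iff_nontrivial] at hM
  refine hM (subsingleton_cohomology_iff.2 fun f hf => ?_)
  let := scalarModule R N M
  have key := cohomologyVanishes_equivariant (X := fun i => C.X i) (d := fun i j => (C.d i j).hom)
    (m := n - r) (r := r) (N := N)
    (fun i j k => by rw [← ModuleCat.hom_comp, C.d_comp_d]; rfl) (fun i _ => hfin i)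
    (fun i hi => by
      have := hn i (by omega)
      exact HasContraction.of_subsingleton) θ hN
    (fun v hv0 i hi f hf => by
      obtain ⟨h, hh⟩ := subsingleton_cohomology_iff.1
        (hv _ (latticeCharacter_mem hθ hN hv0) i hi) (ModuleCat.ofHom f) (by
          refine ModuleCat.hom_ext (LinearMap.ext fun x => ?_)
          exact LinearMap.congr_fun hf x)
      refine ⟨h.hom, ?_⟩
      ext1 x
      exact LinearMap.congr_fun (congrArg ModuleCat.Hom.hom hh) x)
    (moduleAction R N M) i hi'
  rw [cohomologyVanishes_equivariant_iff] at key
  obtain ⟨h, hh, hhf⟩ := key f.hom.toAddMonoidHom (isSubgroupLinear_iff.2 (hom_single_smul f))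
    (fun y => LinearMap.congr_fun (congrArg ModuleCat.Hom.hom hf) y)
  obtain ⟨h', hh'⟩ := exists_hom_of_single_smul h (isSubgroupLinear_iff.1 hh)
  refine ⟨h', ?_⟩
  ext y
  exact (hh' _).trans (hhf y)

end Complex

/-! ### Extending chain complexes to integer degrees -/

section Extend

variable {B : Type w} [Ring B] (K : ChainComplex (ModuleCat.{w'} B) ℕ)

/-- The terms of a chain complex, extended by zero to negative degrees. -/
def extendObj : ℤ → ModuleCat.{w'} B
  | .ofNat k => K.X k
  | .negSucc _ => ModuleCat.of B PUnit

/-- The differentials of a chain complex, extended by zero to negative degrees. -/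
def extendD : ∀ i j, extendObj K i →ₗ[B] extendObj K j
  | .ofNat a, .ofNat b => (K.d a b).hom
  | .ofNat _, .negSucc _ => 0
  | .negSucc _, _ => 0

instance (k : ℕ) : Subsingleton (extendObj K (.negSucc k)) := inferInstanceAs (Subsingleton PUnit)

theorem extendD_comp : ∀ i j k, extendD K j k ∘ₗ extendD K i j = 0
  | .ofNat a, .ofNat b, .ofNat c => by
    change (K.d b c).hom ∘ₗ (K.d a b).hom = 0
    rw [← ModuleCat.hom_comp, K.d_comp_d]
    rfl
  | .ofNat _, .ofNat _, .negSucc _ => LinearMap.zero_comp _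
  | .ofNat _, .negSucc _, _ => LinearMap.zero_comp _
  | .negSucc _, _, _ => LinearMap.comp_zero _

theorem projective_extendObj [Small.{w'} B] (hK : ∀ i, Projective (K.X i)) :
    ∀ i, Module.Projective B (extendObj K i)
  | .ofNat k => (IsProjective.iff_projective (R := B) (K.X k)).2 (hK k)
  | .negSucc _ => inferInstanceAs (Module.Projective B PUnit.{w' + 1})

variable {M : Type*} [AddCommGroup M]

/-- In degree `a`, every cocycle satisfying `L` is the coboundary of a cochain satisfying `L`. -/
def NatVanishing (L : ∀ P : ModuleCat.{w'} B, (P →+ M) → Prop) (a : ℕ) : Prop :=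
  ∀ f : K.X a →+ M, L _ f → (∀ y, f ((K.d (a + 1) a).hom y) = 0) →
    (a = 0 → f = 0) ∧ ∀ b, b + 1 = a → ∃ h : K.X b →+ M, L _ h ∧ ∀ y, h ((K.d a b).hom y) = f y

variable {K}

/-- In degree 0 the preceding term of the extended complex is zero, so being a coboundary means
being zero. -/
theorem natVanishing_iff {L : ∀ P : ModuleCat.{w'} B, (P →+ M) → Prop} (hL : ∀ P, L P 0)
    {a : ℕ} {i : ℤ} (hi : i = a) : NatVanishing K L a ↔
      ∀ f : extendObj K i →+ M, L _ f → (∀ y, f (extendD K (i + 1) i y) = 0) →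
        ∃ h : extendObj K (i - 1) →+ M, L _ h ∧ ∀ y, h (extendD K i (i - 1) y) = f y := by
  subst hi
  have h1 : (a : ℤ) + 1 = Int.ofNat (a + 1) := rfl
  rw [h1]
  rcases a with _ | b
  · change _ ↔ ∀ f : K.X 0 →+ M, L _ f → (∀ y, f ((K.d 1 0).hom y) = 0) →
      ∃ h : extendObj K (.negSucc 0) →+ M, L _ h ∧
        ∀ y, h (extendD K (.ofNat 0) (.negSucc 0) y) = f y
    refine forall_congr' fun f => imp_congr_right fun hf => imp_congr_right fun hf0 => ?_
    constructor
    · intro h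
      refine ⟨0, hL _, fun y => ?_⟩
      rw [h.1 rfl]
      rfl
    · rintro ⟨h, -, hh⟩
      refine ⟨fun _ => AddMonoidHom.ext fun y => ?_, fun b hb => by omega⟩
      rw [← hh y]
      exact map_zero h
  · have h2 : ((b + 1 : ℕ) : ℤ) - 1 = Int.ofNat b := by simp
    rw [h2]
    change _ ↔ ∀ f : K.X (b + 1) →+ M, L _ f → (∀ y, f ((K.d (b + 2) (b + 1)).hom y) = 0) →
      ∃ h : K.X b →+ M, L _ h ∧ ∀ y, h ((K.d (b + 1) b).hom y) = f y
    refine forall_congr' fun f => imp_congr_right fun hf => imp_congr_right fun hf0 => ?_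
    constructor
    · exact fun h => h.2 b rfl
    · rintro h
      refine ⟨fun h => by omega, fun c hc => ?_⟩
      obtain rfl : c = b := by omega
      exact h

theorem natVanishing_linear_iff [Module B M] {a : ℕ} {i : ℤ} (hi : i = a) :
    NatVanishing (M := M) K (fun P f => ∀ (b : B) (p : P), f (b • p) = b • f p) a ↔
      ∀ f : extendObj K i →ₗ[B] M, f ∘ₗ extendD K (i + 1) i = 0 →
        ∃ h : extendObj K (i - 1) →ₗ[B] M, h ∘ₗ extendD K i (i - 1) = f := by
  rw [natVanishing_iff (by simp) hi]
  constructor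
  · intro H f hf
    obtain ⟨h, hh, hhf⟩ := H f.toAddMonoidHom f.map_smul fun y => LinearMap.congr_fun hf y
    exact ⟨{ h with map_smul' := hh }, LinearMap.ext hhf⟩
  · intro H f hf hf0
    obtain ⟨h, hh⟩ := H { f with map_smul' := hf } (LinearMap.ext hf0)
    exact ⟨h.toAddMonoidHom, h.map_smul, fun y => LinearMap.congr_fun hh y⟩

end Extend

section Equivariant

variable {R : Type u} {G : Type v} [Ring R] [Group G] {N : Subgroup G}
variable {A : Type w'} [AddCommGroup A] [Module R A] {ρ : N →* Module.End R A}
variable {K : ChainComplex (ModuleCat.{w} (MonoidAlgebra R G)) ℕ}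

theorem natVanishing_isSubgroupLinear_iff {a : ℕ} {i : ℤ} (hi : i = a) :
    NatVanishing K (fun _ f => IsSubgroupLinear ρ f) a ↔
      CohomologyVanishes (extendD K) (equivariant ρ) i := by
  rw [cohomologyVanishes_equivariant_iff,
    natVanishing_iff (fun P x r p => by simp) hi]

end Equivariant

/-! ### Ext groups and projective resolutions -/

section Ext

theorem subsingleton_ext_iff {C : Type w} [Category.{w'} C] [Abelian C] [HasExt.{u} C] {Z M : C}
    (Q : ProjectiveResolution Z) {a : ℕ} : Subsingleton (Abelian.Ext Z M a) ↔
      ∀ f : Q.complex.X a ⟶ M, Q.complex.d (a + 1) a ≫ f = 0 →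
        (a = 0 → f = 0) ∧ ∀ b, b + 1 = a → ∃ h : Q.complex.X b ⟶ M, Q.complex.d a b ≫ h = f := by
  constructor
  · intro hs f hf
    refine ⟨?_, fun b hb => (Q.extMk_eq_zero_iff f _ rfl hf b hb).1 (Subsingleton.elim _ _)⟩
    rintro rfl
    -- A cocycle in degree 0 factors through the cokernel Z of the differential, and Hom(Z, M) is
    -- Ext in degree 0.
    obtain ⟨g, hg⟩ := Limits.CokernelCofork.IsColimit.desc' Q.isColimitCokernelCofork f hf
    have h0 : (show Z ⟶ M from g) = 0 :=
      (Abelian.Ext.mk₀_eq_zero_iff _).1 (Subsingleton.elim _ _)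
    rw [← hg]
    exact (congrArg (fun g' => Q.cokernelCofork.π ≫ g') h0).trans Limits.comp_zero
  · intro h
    refine subsingleton_of_forall_eq 0 fun α => ?_
    obtain ⟨f, hf, rfl⟩ := Q.extMk_surjective α _ rfl
    obtain ⟨h0, h1⟩ := h f hf
    rcases a with _ | b
    · obtain rfl := h0 rfl
      exact Q.extMk_zero _ _
    · exact (Q.extMk_eq_zero_iff f _ rfl hf b rfl).2 (h1 b rfl)

variable {B : Type w} [Ring B]

theorem natVanishing_linear_iff_ext [HasExt.{u} (ModuleCat.{w'} B)] {Z M : ModuleCat.{w'} B}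
    (Q : ProjectiveResolution Z) {a : ℕ} :
    NatVanishing (M := M) Q.complex (fun P f => ∀ (b : B) (p : P), f (b • p) = b • f p) a ↔
      Subsingleton (Abelian.Ext Z M a) := by
  rw [subsingleton_ext_iff Q]
  constructor
  · intro H f hf
    obtain ⟨h0, h1⟩ := H f.hom.toAddMonoidHom f.hom.map_smul
      fun y => LinearMap.congr_fun (congrArg ModuleCat.Hom.hom hf) y
    refine ⟨fun ha => ?_, fun b hb => ?_⟩
    · ext y
      exact DFunLike.congr_fun (h0 ha) y
    · obtain ⟨h, hh, hhf⟩ := h1 b hb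
      refine ⟨ModuleCat.ofHom { h with map_smul' := hh }, ?_⟩
      ext y
      exact hhf y
  · intro H f hf hf0
    obtain ⟨h0, h1⟩ := H (ModuleCat.ofHom { f with map_smul' := hf }) (by ext y; exact hf0 y)
    refine ⟨fun ha => ?_, fun b hb => ?_⟩
    · ext y
      exact LinearMap.congr_fun (congrArg ModuleCat.Hom.hom (h0 ha)) y
    · obtain ⟨h, hh⟩ := h1 b hb
      exact ⟨h.hom.toAddMonoidHom, h.hom.map_smul,
        fun y => LinearMap.congr_fun (congrArg ModuleCat.Hom.hom hh) y⟩

end Ext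

/-! ### Ext over a subgroup, computed from a resolution over the group -/

section Res

variable {R : Type u} {G : Type v} [Ring R] [Group G] {N : Subgroup G}

instance : (resFunctor R N).PreservesHomology := by
  have h := ((CategoryTheory.Functor.exact_tfae (resFunctor R N)).out 1 2).1 fun S hS => by
    rw [ShortComplex.ShortExact.moduleCat_exact_iff_function_exact] at hS ⊢
    exact hS
  exact h

theorem natVanishing_res_iff_ext {Z : ModuleCat.{max u v} (MonoidAlgebra R G)}
    {M : ModuleCat.{max u v} (MonoidAlgebra R N)} (Q : ProjectiveResolution Z) {a : ℕ} :
    NatVanishing (M := M) Q.complex (fun P f => ∀ (x : N) (r : R) (p : P),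
        f (MonoidAlgebra.single (x : G) r • p) = MonoidAlgebra.single x r • f p) a ↔
      Subsingleton (Abelian.Ext.{max u v} ((resFunctor R N).obj Z) M a) := by
  rw [subsingleton_ext_iff ((resFunctor R N).mapProjectiveResolution Q)]
  constructor
  · intro H f hf
    obtain ⟨h0, h1⟩ := H f.hom.toAddMonoidHom (hom_single_smul f)
      fun y => LinearMap.congr_fun (congrArg ModuleCat.Hom.hom hf) y
    refine ⟨fun ha => ?_, fun b hb => ?_⟩
    · ext y
      exact DFunLike.congr_fun (h0 ha) y
    · obtain ⟨h, hh, hhf⟩ := h1 b hb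
      obtain ⟨h', hh'⟩ := exists_hom_of_single_smul h hh
      refine ⟨h', ?_⟩
      ext y
      exact (hh' _).trans (hhf y)
  · intro H f hf hf0
    obtain ⟨f', hf'⟩ := exists_hom_of_single_smul f hf
    obtain ⟨h0, h1⟩ := H f' (by ext y; exact (hf' _).trans (hf0 y))
    refine ⟨fun ha => ?_, fun b hb => ?_⟩
    · ext y
      exact (hf' y).symm.trans (LinearMap.congr_fun (congrArg ModuleCat.Hom.hom (h0 ha)) y)
    · obtain ⟨h, hh⟩ := h1 b hb
      exact ⟨h.hom.toAddMonoidHom, hom_single_smul h,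
        fun y => (LinearMap.congr_fun (congrArg ModuleCat.Hom.hom hh) y).trans (hf' y)⟩

variable (R N) in
/-- The restriction of the trivial module is the trivial module. -/
def resTrivialIso : (resFunctor R N).obj (trivialModule R G) ≅ trivialModule R N := by
  have h : (augmentation R G).comp (MonoidAlgebra.mapDomainRingHom R N.subtype) =
      augmentation R N := by
    ext <;> simp [augmentation]
  let l : (resFunctor R N).obj (trivialModule R G) ≃ₗ[MonoidAlgebra R N] TrivialCarrier R N :=
    { toFun := fun a => a
      invFun := fun a => a
      map_add' := fun _ _ => rfl
      map_smul' := fun c a => congrArg (fun φ : MonoidAlgebra R N →+* R =>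
        (φ c • (show TrivialCarrier R G from a))) h
      left_inv := fun _ => rfl
      right_inv := fun _ => rfl }
  exact l.toModuleIso

end Res

/-! ### The cohomological dimension of a co-abelian subgroup -/

section Group

variable {R : Type u} {G : Type v} [Ring R] [Group G] {N : Subgroup G} {r : ℕ}
variable {θ : G →* Multiplicative (Fin r → ℤ)}

theorem hasProjectiveDimensionLT_res_iff {k : ℕ} :
    HasProjectiveDimensionLT ((resFunctor R N).obj (trivialModule R G)) k ↔
      HasProjectiveDimensionLT (trivialModule R N) k :=
  ⟨fun _ => hasProjectiveDimensionLT_of_iso (resTrivialIso R N) k,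
    fun _ => hasProjectiveDimensionLT_of_iso (resTrivialIso R N).symm k⟩

theorem hasProjectiveDimensionLT_subgroup (P : ProjectiveResolution (trivialModule R G)) {n : ℕ}
    [HasProjectiveDimensionLT (trivialModule R G) (n + 1)]
    (hfin : ∀ i : ℕ, (n : ℤ) - r < i → Module.Finite (MonoidAlgebra R G) (P.complex.X i))
    (hv : ∀ φ ∈ charactersVanishingOn N, ∀ i : ℕ, n < i + r →
      Subsingleton (groupCohom R G (novikovModule R φ) i))
    (hθ : Function.Surjective θ) (hN : ∀ x ∈ N, θ x = 1) {k : ℕ} (hk : n < k + r) :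
    HasProjectiveDimensionLT (trivialModule R N) k := by
  rw [← hasProjectiveDimensionLT_res_iff]
  refine HasProjectiveDimensionLT.mk fun i hi M e => ?_
  have := projective_extendObj P.complex P.projective
  let := scalarModule R N M
  have key : CohomologyVanishes (extendD P.complex) (equivariant (moduleAction R N M)) (i : ℤ) := by
    refine cohomologyVanishes_equivariant (m := n - r) (extendD_comp _) ?_ ?_ θ hN ?_ _ _ (by omega)
    · rintro (i | i) hi
      · exact hfin i hi
      · exact Module.Finite.of_finite
    · rintro (i | i) hi
      -- The resolution may be longer than n, but Ext above n vanishes for all coefficients, in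
      -- particular for the quotient X i / im d, and this forces exact contractions there.
      · refine HasContraction.of_vanishing ((natVanishing_linear_iff rfl).1 ?_)
        refine (natVanishing_linear_iff_ext (M := ModuleCat.of _ _) P).2 ?_
        refine HasProjectiveDimensionLT.subsingleton.{max u v} _ (n + 1) _ ?_ _
        have : (Int.ofNat i : ℤ) = i := rfl
        omega
      · exact HasContraction.of_subsingleton
    · rintro v hv0 (i | i) hi
      · refine (natVanishing_linear_iff rfl).1 ?_
        refine (natVanishing_linear_iff_ext (M := ModuleCat.of _ _) P).2 ?_
        refine hv _ (latticeCharacter_mem hθ hN hv0) i ?_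
        have : (Int.ofNat i : ℤ) = i := rfl
        omega
      · exact fun f _ => ⟨0, LinearMap.ext fun x => by
          rw [Subsingleton.elim x 0, map_zero, map_zero]⟩
  have := (natVanishing_res_iff_ext P).1 (by
    simpa only [isSubgroupLinear_iff] using (natVanishing_isSubgroupLinear_iff rfl).2 key)
  exact Subsingleton.elim _ _

/-- The last flag subgroup is G itself, and coinduction from G to G returns M. Climbing the flag
from N therefore costs r degrees. -/
theorem hasProjectiveDimensionLT_of_subgroup (hθ : Function.Surjective θ)
    (hN : ∀ x, x ∈ N ↔ θ x = 1) (k : ℕ) [hk : HasProjectiveDimensionLT (trivialModule R N) k] :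
    HasProjectiveDimensionLT (trivialModule R G) (k + r) := by
  obtain rfl : N = flagSubgroup θ 0 := by
    ext x
    rw [hN, mem_flagSubgroup]
    constructor
    · intro h
      simp [h]
    · intro h
      apply Multiplicative.toAdd.injective
      funext l
      exact h l (Nat.zero_le _)
  rw [← hasProjectiveDimensionLT_res_iff] at hk
  refine HasProjectiveDimensionLT.mk fun i hi M e => ?_
  let P := ProjectiveResolution.of (trivialModule R G)
  have := projective_extendObj P.complex P.projective
  let := scalarModule R G M
  have hlin : ∀ (H : Subgroup G) (Q : ModuleCat.{max u v} (MonoidAlgebra R G)) (f : Q →+ M),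
      IsSubgroupLinear ((moduleAction R G M).comp H.subtype) f ↔ ∀ (x : H) (r : R) (q : Q),
        f (MonoidAlgebra.single (x : G) r • q) = MonoidAlgebra.single (x : G) r • f q := by
    intro H Q f
    refine forall_congr' fun x => forall_congr' fun r => forall_congr' fun p => ?_
    rw [MonoidHom.comp_apply, smul_groupAction_apply]
    rfl
  have key : CohomologyVanishes (extendD P.complex)
      (equivariant ((moduleAction R G M).comp (flagSubgroup θ r).subtype)) (i : ℤ) := by
    -- With m = k - 1 the condition m < i reads k ≤ i.
    refine CohomologyVanishes.flagSubgroup (m := k - 1) (extendD_comp _) hθ ?_ r le_rfl i (by omega)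
    rintro (i | i) hi
    · refine (natVanishing_isSubgroupLinear_iff rfl).1 ?_
      simp only [hlin]
      have hs := HasProjectiveDimensionLT.subsingleton.{max u v}
        ((resFunctor R (flagSubgroup θ 0)).obj (trivialModule R G)) k i
        (by have : (Int.ofNat i : ℤ) = i := rfl
            omega) ((resFunctor R (flagSubgroup θ 0)).obj M)
      intro f hf hf0
      obtain ⟨h0, h1⟩ := (natVanishing_res_iff_ext P).2 hs f
        (fun x r p => (hf x r p).trans (res_single_smul M x r (f p)).symm) hf0
      refine ⟨h0, fun b hb => ?_⟩
      obtain ⟨h, hh, hhf⟩ := h1 b hb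
      exact ⟨h, fun x r p => (hh x r p).trans (res_single_smul M x r (h p)), hhf⟩
    · intro f _ _
      exact ⟨0, fun _ => Submodule.zero_mem _, LinearMap.ext fun x => by
          rw [Subsingleton.elim x 0, map_zero, map_zero]⟩
  have h1 := (natVanishing_isSubgroupLinear_iff rfl).2 key
  simp only [hlin] at h1
  have h2 : NatVanishing (M := M) P.complex
      (fun Q f => ∀ (b : MonoidAlgebra R G) (p : Q), f (b • p) = b • f p) i := by
    intro f hf hf0
    obtain ⟨h0, h1⟩ := h1 f (fun x r p => hf _ p) hf0
    refine ⟨h0, fun b hb => ?_⟩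
    obtain ⟨h, hh, hhf⟩ := h1 b hb
    refine ⟨h, (linearMapOfSingle h fun g r p =>
      hh ⟨g, mem_flagSubgroup.2 fun l hl => absurd l.2 (by omega)⟩ r p).map_smul, hhf⟩
  have := (natVanishing_linear_iff_ext P).1 h2
  exact Subsingleton.elim _ _

theorem cd_subgroup_eq [Nontrivial R] {n : ℕ} (hG : IsFPStar R G r) (hn : cd R G = n)
    (hθ : Function.Surjective θ) (hN : ∀ x, x ∈ N ↔ θ x = 1)
    (hS : charactersVanishingOn N ⊆ sigmaStar R G r) :
    r ≤ n ∧ cd R N = ((n - r : ℕ) : WithBot ℕ∞) := by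
  obtain ⟨n', hn', P, hfin⟩ := hG
  obtain rfl : n' = n := by exact_mod_cast hn'.symm.trans hn
  have hn1 : HasProjectiveDimensionLT (trivialModule R G) (n' + 1) :=
    (projectiveDimension_le_iff _ _).1 hn.le
  have upper : ∀ k : ℕ, n' < k + r → HasProjectiveDimensionLT (trivialModule R N) k := fun k hk =>
    hasProjectiveDimensionLT_subgroup P hfin
      (fun φ hφ i hi => (hS hφ).2 i (by rw [hn]; exact_mod_cast hi)) hθ (fun x => (hN x).1) hk
  have hr : r ≤ n' := by
    -- If r exceeded n, the trivial module would have negative projective dimension and thus be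
    -- zero, contrary to R ≠ 0.
    by_contra h
    have := upper 0 (by omega)
    have h0 := isZero_of_hasProjectiveDimensionLT_zero (trivialModule R N)
    have h1 : Subsingleton (TrivialCarrier R N) := ModuleCat.subsingleton_of_isZero h0
    exact not_subsingleton (ULift.{v} R) h1
  refine ⟨hr, le_antisymm ((projectiveDimension_le_iff _ _).2 (upper _ (by omega)))
    ((projectiveDimension_ge_iff _ _).2 fun h => ?_)⟩
  -- Projective dimension below n - r over N would give projective dimension below n over G.
  have := hasProjectiveDimensionLT_of_subgroup (R := R) hθ hN (n' - r)
  rw [Nat.sub_add_cancel hr] at this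
  exact (projectiveDimension_ge_iff _ _).1 hn.ge this

end Group

end CoAbelian

end

theorem theoremE (R : Type u) [Ring R] [Nontrivial R] (G : Type v) [Group G] :
    -- the statement for groups
    (∀ (d n : ℕ) (N : Subgroup G) [N.Normal],
      CoAbelian.IsFPStar R G d →
      CoAbelian.cd R G = n →
      Nonempty (G ⧸ N ≃* Multiplicative (Fin d → ℤ)) →
      CoAbelian.charactersVanishingOn N ⊆ CoAbelian.sigmaStar R G d →
      d ≤ n ∧ CoAbelian.cd R N = ((n - d : ℕ) : WithBot ℕ∞)) ∧
    -- the statement for chain complexes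
    (∀ (C : ChainComplex (ModuleCat.{max u v} (MonoidAlgebra R G)) ℤ) (n : ℤ) (d : ℕ)
      (χ : CoAbelian.Character G),
      (∀ i, Module.Projective (MonoidAlgebra R G) (C.X i)) →
      (∀ i, Module.Finite (MonoidAlgebra R G) (C.X i)) →
      (∀ i, n < i → Subsingleton (C.X i)) →
      Nonempty (χ.range ≃* Multiplicative (Fin d → ℤ)) →
      (∀ φ ∈ CoAbelian.charactersVanishingOn χ.ker, ∀ i : ℤ, n - d < i →
        Subsingleton (CoAbelian.cohomology C (CoAbelian.novikovModule R φ) i)) →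
      CoAbelian.complexCd (CoAbelian.resComplex R χ.ker C) ≤
        (((n - d : ℤ) : WithTop ℤ) : WithBot (WithTop ℤ))) := by
  refine ⟨fun d n N _ hG hn ⟨e⟩ hS => ?_, fun C n d χ hproj hfin hn ⟨e⟩ hv => ?_⟩
  · refine CoAbelian.cd_subgroup_eq (θ := e.toMonoidHom.comp (QuotientGroup.mk' N)) hG hn
      (e.surjective.comp (QuotientGroup.mk'_surjective N)) (fun x => ?_) hS
    simp
  · refine CoAbelian.complexCd_resComplex_le C n (e.toMonoidHom.comp χ.rangeRestrict)
      (e.surjective.comp χ.rangeRestrict_surjective) (fun x hx => ?_) hproj hfin hn hv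
    have : χ.rangeRestrict x = 1 := Subtype.ext hx
    simp [this]
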